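/- All Hilbert spaces are finite dimensional, $\log$ is the logarithm to base $2$ with $\log 0=-\infty$ and $\log\infty=\infty$, and all divergences take values in $[-\infty,\infty]$. For positive semidefinite $A,B$ and $\beta\in(0,1)$, the $\beta$-geometric mean is $$A\#_\beta B=\lim_{\varepsilon\downarrow 0}A_\varepsilon^{1/2}\bigl(A_\varepsilon^{-1/2}B_\varepsilon A_\varepsilon^{-1/2}\bigr)^{\beta}A_\varepsilon^{1/2},\qquad A_\varepsilon=A+\varepsilon I,\quad B_\varepsilon=B+\varepsilon I.$$ For $\alpha\in(1,\infty)$ and positive semidefinite operators $\rho,\sigma$ (not necessarily normalized) put $$D^{\#}_\alpha(\rho\|\sigma)=\frac1{\alpha-1}\log\,\inf\bigl\{\operatorname{tr}A : A\ge 0,\ \rho\le\sigma\#_{1/\alpha}A\bigr\},\qquad \inf\emptyset=\infty,$$ $$\widetilde D_\alpha(\rho\|\sigma)=\frac1{\alpha-1}\log\operatorname{tr}\Bigl(\bigl(\sigma^{\frac{1-\alpha}{2\alpha}}\rho\,\sigma^{\frac{1-\alpha}{2\alpha}}\bigr)^{\alpha}\Bigr)\ \text{ if } \operatorname{supp}\rho\subseteq\operatorname{supp}\sigma,\qquad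 \widetilde D_\alpha(\rho\|\sigma)=\infty\ \text{ otherwise},$$ where negative powers are taken on the support. For a completely positive map $\mathcal N$ from $\mathscr L(X)$ to $\mathscr L(Y)$ let $J^{\mathcal N}_{XY}=\sum_{x,x'}|x\rangle\langle x'|\otimes\mathcal N(|x\rangle\langle x'|)$ be its Choi matrix with respect to a fixed orthonormal basis $\{|x\rangle\}$ of $X$. For $\mathbf D\in\{D^{\#}_\alpha,\widetilde D_\alpha\}$ and completely positive $\mathcal N,\mathcal M$ let $$\mathbf D(\mathcal N\|\mathcal M)=\sup_{\omega}\ \mathbf D\bigl(\omega_X^{1/2}J^{\mathcal N}_{XY}\omega_X^{1/2}\,\big\|\,\omega_X^{1/2}J^{\mathcal M}_{XY}\omega_X^{1/2}\bigr),$$ the supremum being over all density operators $\omega$ on $X$, with $\omega_X^{1/2}$ standing for $\omega^{1/2}\otimes I_Y$. **Lemma.** Let $\mathcal N$ and $\mathcal M$ be completely positive maps from $\mathscr L(X)$ to $\mathscr L(Y)$, and let $d=\dim X\,\dim Y$. Then for every integer $n\ge1$ and every $\alpha\in(1,\infty)$, $$\frac1n D^{\#}_\alpha(\mathcal N^{\otimes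 n}\|\mathcal M^{\otimes n})-\frac1n\,\frac{\alpha}{\alpha-1}(d^2+d)\log(n+d)\ \le\ \frac1n\widetilde D_\alpha(\mathcal N^{\otimes n}\|\mathcal M^{\otimes n})\ \le\ \frac1n D^{\#}_\alpha(\mathcal N^{\otimes n}\|\mathcal M^{\otimes n}).$$ -/

import Mathlib

open scoped ComplexOrder Topology Kronecker ENNReal

noncomputable section

namespace QDiv

section Operators

variable {ι : Type*} [Fintype ι] [DecidableEq ι]

/-- Operators on the Hilbert space `ℂ^ι` are matrices indexed by `ι`. For a positive semidefinite
matrix `A`, this is the power `A ^ p` (functional calculus). Since `Real.rpow` satisfies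
`0 ^ p = 0` for every `p ≠ 0`, negative powers are powers of the generalized inverse, i.e. the
inverse on the support. -/
def psdPow (A : Matrix ι ι ℂ) (p : ℝ) : Matrix ι ι ℂ :=
  cfc (fun t : ℝ => t ^ p) A

/-- Loewner order: `A ≤ B` iff `B - A` is positive semidefinite. -/
def LoewnerLE (A B : Matrix ι ι ℂ) : Prop :=
  (B - A).PosSemidef

/-- `ρ ≪ σ`: the support of `ρ` is contained in the support of `σ`. The support of a Hermitian
matrix (the orthogonal complement of its kernel) is its range. -/
def SuppLE (ρ σ : Matrix ι ι ℂ) : Prop :=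
  LinearMap.range ρ.mulVecLin ≤ LinearMap.range σ.mulVecLin

/-- The weighted geometric mean `A^{1/2} (A^{-1/2} B A^{-1/2})^β A^{1/2}` of `A` and `B`, for
positive definite `A`. -/
def geomMeanPos (β : ℝ) (A B : Matrix ι ι ℂ) : Matrix ι ι ℂ :=
  psdPow A (1 / 2) * psdPow (psdPow A (-(1 / 2)) * B * psdPow A (-(1 / 2))) β * psdPow A (1 / 2)

/-- The `β`-geometric mean `A #_β B` of positive semidefinite matrices `A` and `B`: the limit, as
`ε ↓ 0`, of the geometric means of the positive definite matrices `A + ε I` and `B + ε I`. -/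
def geomMean (β : ℝ) (A B : Matrix ι ι ℂ) : Matrix ι ι ℂ :=
  Filter.limUnder (𝓝[>] (0 : ℝ)) fun ε : ℝ =>
    geomMeanPos β (A + (ε : ℂ) • (1 : Matrix ι ι ℂ)) (B + (ε : ℂ) • (1 : Matrix ι ι ℂ))

end Operators

/-- Logarithm to base `2` of an element of `[0, ∞]`, with `log 0 = -∞` and `log ∞ = ∞`. -/
def log2 (x : ℝ≥0∞) : EReal :=
  if x = 0 then ⊥ else if x = ⊤ then ⊤ else ((Real.logb 2 x.toReal : ℝ) : EReal)

section Divergences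

variable {ι : Type*} [Fintype ι] [DecidableEq ι]

/-- `Q#_α(ρ‖σ)`: the infimum of `tr A` over all `A ≥ 0` with `ρ ≤ σ #_{1/α} A`
(`∞` if there is no such `A`). -/
def sharpQ (α : ℝ) (ρ σ : Matrix ι ι ℂ) : ℝ≥0∞ :=
  ⨅ (A : Matrix ι ι ℂ) (_ : A.PosSemidef) (_ : LoewnerLE ρ (geomMean (1 / α) σ A)),
    ENNReal.ofReal A.trace.re

/-- The `#` Rényi divergence `D#_α(ρ‖σ)`. -/
def sharpD (α : ℝ) (ρ σ : Matrix ι ι ℂ) : EReal :=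
  ((1 / (α - 1) : ℝ) : EReal) * log2 (sharpQ α ρ σ)

open Classical in
/-- `tr ((σ^{(1-α)/(2α)} ρ σ^{(1-α)/(2α)})^α)` if `ρ ≪ σ`, and `∞` otherwise. -/
def sandwichedQ (α : ℝ) (ρ σ : Matrix ι ι ℂ) : ℝ≥0∞ :=
  if SuppLE ρ σ then
    ENNReal.ofReal
      (psdPow (psdPow σ ((1 - α) / (2 * α)) * ρ * psdPow σ ((1 - α) / (2 * α))) α).trace.re
  else ⊤

/-- The sandwiched Rényi divergence `D̃_α(ρ‖σ)` (no normalization of `ρ` is built in). -/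
def sandwichedD (α : ℝ) (ρ σ : Matrix ι ι ℂ) : EReal :=
  ((1 / (α - 1) : ℝ) : EReal) * log2 (sandwichedQ α ρ σ)

end Divergences

section Channels

variable {X Y : Type*} [Fintype X] [DecidableEq X] [Fintype Y] [DecidableEq Y]

open scoped MatrixOrder Matrix.Norms.L2Operator in
/-- A linear map between full matrix algebras is completely positive. -/
def IsCP (N : Matrix X X ℂ →ₗ[ℂ] Matrix Y Y ℂ) : Prop :=
  ∃ F : CompletelyPositiveMap (Matrix X X ℂ) (Matrix Y Y ℂ), F.toLinearMap = N

/-- The map `id_R ⊗ N`, which applies `N` to each block of a matrix in block form. -/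
def idTensor (R : Type*) (N : Matrix X X ℂ →ₗ[ℂ] Matrix Y Y ℂ) :
    Matrix (R × X) (R × X) ℂ →ₗ[ℂ] Matrix (R × Y) (R × Y) ℂ where
  toFun A := Matrix.of fun p q => N (Matrix.of fun x x' => A (p.1, x) (q.1, x')) p.2 q.2
  map_add' A B := by
    ext p q
    exact congrFun (congrFun (N.map_add (Matrix.of fun x x' => A (p.1, x) (q.1, x'))
      (Matrix.of fun x x' => B (p.1, x) (q.1, x'))) p.2) q.2
  map_smul' c A := by
    ext p q
    exact congrFun (congrFun (N.map_smul c (Matrix.of fun x x' => A (p.1, x) (q.1, x'))) p.2) q.2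

/-- `Φ = ∑_{x,x'} |x⟩⟨x'| ⊗ |x⟩⟨x'|`, the unnormalized maximally entangled state. -/
def maxEnt (X : Type*) [Fintype X] [DecidableEq X] : Matrix (X × X) (X × X) ℂ :=
  ∑ x : X, ∑ x' : X, Matrix.single x x' (1 : ℂ) ⊗ₖ Matrix.single x x' (1 : ℂ)

/-- The Choi matrix `(id_X ⊗ N)(Φ)` of `N`. -/
def choi (N : Matrix X X ℂ →ₗ[ℂ] Matrix Y Y ℂ) : Matrix (X × Y) (X × Y) ℂ :=
  idTensor X N (maxEnt X)

/-- The operator `ω_X^{1/2} J_{XY} ω_X^{1/2}`, where `ω_X^{1/2}` stands for `ω_X^{1/2} ⊗ I_Y`. -/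
def conjSqrt (ω : Matrix X X ℂ) (J : Matrix (X × Y) (X × Y) ℂ) : Matrix (X × Y) (X × Y) ℂ :=
  (psdPow ω (1 / 2) ⊗ₖ (1 : Matrix Y Y ℂ)) * J * (psdPow ω (1 / 2) ⊗ₖ (1 : Matrix Y Y ℂ))

/-- The channel divergence induced by a divergence `D` of positive semidefinite operators: the
supremum over all density operators `ω` on the input space. -/
def channelDiv (D : Matrix (X × Y) (X × Y) ℂ → Matrix (X × Y) (X × Y) ℂ → EReal)
    (N M : Matrix X X ℂ →ₗ[ℂ] Matrix Y Y ℂ) : EReal :=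
  ⨆ (ω : Matrix X X ℂ) (_ : ω.PosSemidef) (_ : ω.trace = 1),
    D (conjSqrt ω (choi N)) (conjSqrt ω (choi M))

/-- The tensor power `N^{⊗n}` as a map from operators on `(ℂ^X)^{⊗n} = ℂ^(X^n)` to operators on
`(ℂ^Y)^{⊗n} = ℂ^(Y^n)`: the linear map which sends each matrix unit
`|x⟩⟨x'| = ⨂ᵢ |xᵢ⟩⟨x'ᵢ|` to `⨂ᵢ N(|xᵢ⟩⟨x'ᵢ|)`. -/
def tensorPow (n : ℕ) (N : Matrix X X ℂ →ₗ[ℂ] Matrix Y Y ℂ) :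
    Matrix (Fin n → X) (Fin n → X) ℂ →ₗ[ℂ] Matrix (Fin n → Y) (Fin n → Y) ℂ where
  toFun A := Matrix.of fun y y' =>
    ∑ x : Fin n → X, ∑ x' : Fin n → X,
      A x x' * ∏ i, N (Matrix.single (x i) (x' i) 1) (y i) (y' i)
  map_add' A B := by
    ext y y'
    simp [add_mul, Finset.sum_add_distrib]
  map_smul' c A := by
    ext y y'
    simp [mul_assoc, Finset.mul_sum]

/-- `N^{⊗n}` is the map `⨂ᵢ Aᵢ ↦ ⨂ᵢ N(Aᵢ)`. -/
theorem tensorPow_apply_prod (n : ℕ) (N : Matrix X X ℂ →ₗ[ℂ] Matrix Y Y ℂ)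
    (A : Fin n → Matrix X X ℂ) :
    tensorPow n N (Matrix.of fun x x' => ∏ i, A i (x i) (x' i)) =
      Matrix.of fun y y' => ∏ i, N (A i) (y i) (y' i) := by
  have key : ∀ (B : Matrix X X ℂ) (y y' : Y),
      N B y y' = ∑ p : X × X, B p.1 p.2 * N (Matrix.single p.1 p.2 1) y y' := by
    intro B y y'
    conv_lhs => rw [Matrix.matrix_eq_sum_single B]
    simp only [map_sum, Matrix.sum_apply, Fintype.sum_prod_type]
    refine Finset.sum_congr rfl fun x _ => Finset.sum_congr rfl fun x' _ => ?_
    have h : Matrix.single x x' (B x x') = B x x' • Matrix.single x x' (1 : ℂ) := by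
      simp [Matrix.smul_single]
    rw [h, map_smul, Matrix.smul_apply, smul_eq_mul]
  ext y y'
  simp only [tensorPow, LinearMap.coe_mk, AddHom.coe_mk, Matrix.of_apply]
  simp_rw [key (A _), Finset.prod_univ_sum, Fintype.piFinset_univ, Finset.prod_mul_distrib]
  rw [← Fintype.sum_prod_type']
  exact Fintype.sum_equiv (Equiv.arrowProdEquivProdArrow (Fin n) (fun _ => X) (fun _ => X)).symm
    _ _ (fun p => rfl)

end Channels

end QDiv

end

/-! The upper bound holds for each input state separately. Put `s = (1-α)/(2α)` and let `A` be
feasible, so `ρ ≤ σ #_{1/α} A`. Conjugating by `σ^s` and using monotonicity of `tr (·)^α` bounds the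
sandwiched quantity by `tr (σ^{1/(2α)} Z^{1/α} σ^{1/(2α)})^α` with `Z = σ^{-1/2} A σ^{-1/2}`. By the
Araki–Lieb–Thirring inequality (`trace_psdPow_le_of_posDef`) this is at most `tr (σ^{1/2} Z σ^{1/2})
= tr A`. `trace_sandwiched_le` passes to singular `σ` and `A`.

The lower bound reduces to permutation-invariant inputs and then pinches. Let `τ` be the average of
an input `ω` over permutations of the `n` tensor factors. The pair built from `ω` arises from the
pair built from `τ` by a family of conjugations that is trace nonincreasing on average, so `sharpQ`
is no smaller at `τ` (`sharpQ_le_symmetrize`). The underlying fact is the transformer inequality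
`conj_geomMean_le`, which carries feasible operators to feasible operators.

At `τ` the second operator `σ` commutes with the permutations. Entries of its spectral projections
depend only on the type of the index sequence, so it has at most `v = (n+1)^(d^2)` distinct
eigenvalues (`card_eigenvalues_le`). Pinching gives `ρ ≤ v P(ρ)`, where `P(ρ)` commutes with `σ`.
The commuting problem `σ #_{1/α} A = v P(ρ)` is solved explicitly, and Peierls' inequality compares
`tr A` with the sandwiched quantity of the unpinched pair (`sharpQ_le_mul_sandwichedQ`). The loss is
the factor `v^α`, which becomes `α/(α-1) log v` after taking logarithms; `logb_pow_le` relaxes it to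
the stated form. -/

noncomputable section

set_option linter.unusedSectionVars false

namespace QDiv

open scoped Matrix

/-! ### Spectral decompositions and real powers of matrices -/

section SpectralForm

variable {ι κ : Type*} [Fintype ι] [DecidableEq ι] [Fintype κ] [DecidableEq κ]

/-- The matrix with real eigenvalues `d` and eigenvectors the columns of `U`. -/
def spec (U : Matrix ι ι ℂ) (d : ι → ℝ) : Matrix ι ι ℂ :=
  U * Matrix.diagonal (fun i => (d i : ℂ)) * Uᴴ

theorem unitary_conjTranspose_mul {U : Matrix ι ι ℂ} (hU : U ∈ Matrix.unitaryGroup ι ℂ) :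
    Uᴴ * U = 1 := Matrix.mem_unitaryGroup_iff'.1 hU

theorem unitary_mul_conjTranspose {U : Matrix ι ι ℂ} (hU : U ∈ Matrix.unitaryGroup ι ℂ) :
    U * Uᴴ = 1 := Matrix.mem_unitaryGroup_iff.1 hU

theorem spec_mul {U : Matrix ι ι ℂ} (hU : U ∈ Matrix.unitaryGroup ι ℂ) (d e : ι → ℝ) :
    spec U d * spec U e = spec U (fun i => d i * e i) := by
  have h : spec U d * spec U e = U * Matrix.diagonal (fun i => (d i : ℂ)) * (Uᴴ * U) *
      Matrix.diagonal (fun i => (e i : ℂ)) * Uᴴ := by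
    simp only [spec, Matrix.mul_assoc]
  rw [h, unitary_conjTranspose_mul hU, Matrix.mul_one, Matrix.mul_assoc U,
    Matrix.diagonal_mul_diagonal]
  simp [spec]

theorem spec_add (U : Matrix ι ι ℂ) (d e : ι → ℝ) :
    spec U d + spec U e = spec U (fun i => d i + e i) := by
  simp only [spec, ← Matrix.add_mul, ← Matrix.mul_add, Matrix.diagonal_add, Complex.ofReal_add]

theorem spec_smul (U : Matrix ι ι ℂ) (c : ℝ) (d : ι → ℝ) :
    (c : ℂ) • spec U d = spec U (fun i => c * d i) := by
  simp only [spec, Complex.ofReal_mul]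
  rw [← Matrix.smul_mul, ← Matrix.mul_smul, ← Matrix.diagonal_smul]
  rfl

theorem spec_const {U : Matrix ι ι ℂ} (hU : U ∈ Matrix.unitaryGroup ι ℂ) (c : ℝ) :
    spec U (fun _ => c) = (c : ℂ) • 1 := by
  have h : spec U (fun _ => (1 : ℝ)) = 1 := by
    simp [spec, unitary_mul_conjTranspose hU]
  rw [← h, spec_smul]; simp

theorem spec_conjTranspose (U : Matrix ι ι ℂ) (d : ι → ℝ) : (spec U d)ᴴ = spec U d := by
  simp only [spec, Matrix.conjTranspose_mul, Matrix.conjTranspose_conjTranspose,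
    Matrix.diagonal_conjTranspose, Matrix.mul_assoc]
  congr 3
  ext i; simp

theorem spec_trace {U : Matrix ι ι ℂ} (hU : U ∈ Matrix.unitaryGroup ι ℂ) (d : ι → ℝ) :
    (spec U d).trace = ((∑ i, d i : ℝ) : ℂ) := by
  rw [spec, Matrix.trace_mul_cycle, unitary_conjTranspose_mul hU]
  simp [Matrix.trace]

theorem spec_posSemidef (U : Matrix ι ι ℂ) {d : ι → ℝ} (hd : ∀ i, 0 ≤ d i) :
    (spec U d).PosSemidef :=
  (Matrix.PosSemidef.diagonal (fun i => by simpa using hd i)).mul_mul_conjTranspose_same U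

theorem unitary_isUnit {U : Matrix ι ι ℂ} (hU : U ∈ Matrix.unitaryGroup ι ℂ) : IsUnit U :=
  IsUnit.of_mul_eq_one _ (unitary_mul_conjTranspose hU)

theorem spec_posDef {U : Matrix ι ι ℂ} (hU : U ∈ Matrix.unitaryGroup ι ℂ) {d : ι → ℝ}
    (hd : ∀ i, 0 < d i) : (spec U d).PosDef := by
  refine (Matrix.IsUnit.posDef_star_right_conjugate_iff (unitary_isUnit hU)).2 ?_
  exact Matrix.PosDef.diagonal (fun i => by simpa using hd i)

theorem exists_spec {A : Matrix ι ι ℂ} (hA : A.IsHermitian) :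
    ∃ U ∈ Matrix.unitaryGroup ι ℂ, A = spec U hA.eigenvalues ∧
      ∀ f : ℝ → ℝ, cfc f A = spec U (fun i => f (hA.eigenvalues i)) := by
  refine ⟨hA.eigenvectorUnitary, hA.eigenvectorUnitary.2, ?_, fun f => ?_⟩
  · conv_lhs => rw [hA.spectral_theorem]
    rfl
  · rw [hA.cfc_eq]; rfl

theorem exists_spec_posSemidef {A : Matrix ι ι ℂ} (hA : A.PosSemidef) :
    ∃ U ∈ Matrix.unitaryGroup ι ℂ, ∃ d : ι → ℝ, (∀ i, 0 ≤ d i) ∧ A = spec U d := by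
  obtain ⟨U, hU, h, -⟩ := exists_spec hA.1
  exact ⟨U, hU, _, hA.eigenvalues_nonneg, h⟩

theorem exists_spec_posDef {A : Matrix ι ι ℂ} (hA : A.PosDef) :
    ∃ U ∈ Matrix.unitaryGroup ι ℂ, ∃ d : ι → ℝ, (∀ i, 0 < d i) ∧ A = spec U d := by
  obtain ⟨U, hU, h, -⟩ := exists_spec hA.1
  exact ⟨U, hU, _, hA.eigenvalues_pos, h⟩

/-- In the two eigenbases the hypothesis reads `d i * M i j = M i j * e j`, so wherever `M i j` is
nonzero the eigenvalues agree, and so do their images under `f`. With `K = 1` this shows that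
functional calculus does not depend on the chosen eigenbasis; rectangular and singular `K` are
allowed. -/
theorem spec_intertwine {U : Matrix ι ι ℂ} (hU : U ∈ Matrix.unitaryGroup ι ℂ)
    {V : Matrix κ κ ℂ} (hV : V ∈ Matrix.unitaryGroup κ ℂ) {d : ι → ℝ} {e : κ → ℝ}
    {K : Matrix ι κ ℂ} (h : spec U d * K = K * spec V e) (f : ℝ → ℝ) :
    spec U (fun i => f (d i)) * K = K * spec V (fun i => f (e i)) := by
  have key : ∀ (d : ι → ℝ) (e : κ → ℝ), spec U d * K = K * spec V e ↔
      ∀ i j, (d i : ℂ) * (Uᴴ * K * V) i j = (Uᴴ * K * V) i j * (e j : ℂ) := by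
    intro d e
    have h1 : (∀ i j, (d i : ℂ) * (Uᴴ * K * V) i j = (Uᴴ * K * V) i j * (e j : ℂ)) ↔
        Matrix.diagonal (fun i => (d i : ℂ)) * (Uᴴ * K * V) =
          (Uᴴ * K * V) * Matrix.diagonal (fun i => (e i : ℂ)) := by
      rw [← Matrix.ext_iff]
      simp [Matrix.diagonal_mul, Matrix.mul_diagonal]
    rw [h1]
    constructor
    · intro h
      have := congrArg (fun M => Uᴴ * M * V) h
      simp only [spec, Matrix.mul_assoc] at this
      rw [← Matrix.mul_assoc Uᴴ U, unitary_conjTranspose_mul hU, unitary_conjTranspose_mul hV] at this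
      simpa [Matrix.mul_assoc] using this
    · intro h
      have := congrArg (fun M => U * M * Vᴴ) h
      simp only [Matrix.mul_assoc] at this
      rw [← Matrix.mul_assoc U Uᴴ, unitary_mul_conjTranspose hU, unitary_mul_conjTranspose hV] at this
      simpa [spec, Matrix.mul_assoc] using this
  rw [key] at h ⊢
  intro i j
  by_cases h0 : (Uᴴ * K * V) i j = 0
  · simp [h0]
  · have := h i j
    rw [mul_comm] at this
    have := mul_left_cancel₀ h0 this
    rw [mul_comm, Complex.ofReal_inj.1 this]

theorem cfc_spec {U : Matrix ι ι ℂ} (hU : U ∈ Matrix.unitaryGroup ι ℂ) (d : ι → ℝ) (f : ℝ → ℝ) :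
    cfc f (spec U d) = spec U (fun i => f (d i)) := by
  have hH : (spec U d).IsHermitian := spec_conjTranspose U d
  obtain ⟨V, hV, h, hf⟩ := exists_spec hH
  rw [hf f]
  have := spec_intertwine hV hU (K := 1) (d := hH.eigenvalues) (e := d)
    (by rw [Matrix.mul_one, Matrix.one_mul]; exact h.symm) f
  simpa using this

theorem psdPow_spec {U : Matrix ι ι ℂ} (hU : U ∈ Matrix.unitaryGroup ι ℂ) (d : ι → ℝ) (p : ℝ) :
    psdPow (spec U d) p = spec U (fun i => d i ^ p) := cfc_spec hU d _

theorem cfc_intertwine {A : Matrix ι ι ℂ} (hA : A.IsHermitian) {B : Matrix κ κ ℂ}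
    (hB : B.IsHermitian) {K : Matrix ι κ ℂ} (h : A * K = K * B) (f : ℝ → ℝ) :
    cfc f A * K = K * cfc f B := by
  obtain ⟨U, hU, hA1, hA2⟩ := exists_spec hA
  obtain ⟨V, hV, hB1, hB2⟩ := exists_spec hB
  rw [hA2, hB2]
  exact spec_intertwine hU hV (by rwa [← hA1, ← hB1]) f

theorem psdPow_intertwine {A : Matrix ι ι ℂ} (hA : A.IsHermitian) {B : Matrix κ κ ℂ}
    (hB : B.IsHermitian) {K : Matrix ι κ ℂ} (h : A * K = K * B) (p : ℝ) :
    psdPow A p * K = K * psdPow B p := cfc_intertwine hA hB h _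

theorem psdPow_isHermitian (A : Matrix ι ι ℂ) (p : ℝ) : (psdPow A p).IsHermitian :=
  (cfc_predicate (fun t : ℝ => t ^ p) A : IsSelfAdjoint _)

theorem psdPow_conjTranspose (A : Matrix ι ι ℂ) (p : ℝ) : (psdPow A p)ᴴ = psdPow A p :=
  psdPow_isHermitian A p

theorem psdPow_posSemidef {A : Matrix ι ι ℂ} (hA : A.PosSemidef) (p : ℝ) :
    (psdPow A p).PosSemidef := by
  obtain ⟨U, hU, d, hd, rfl⟩ := exists_spec_posSemidef hA
  rw [psdPow_spec hU]
  exact spec_posSemidef U fun i => Real.rpow_nonneg (hd i) p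

theorem psdPow_posDef {A : Matrix ι ι ℂ} (hA : A.PosDef) (p : ℝ) :
    (psdPow A p).PosDef := by
  obtain ⟨U, hU, d, hd, rfl⟩ := exists_spec_posDef hA
  rw [psdPow_spec hU]
  exact spec_posDef hU fun i => Real.rpow_pos_of_pos (hd i) p

theorem psdPow_add {A : Matrix ι ι ℂ} (hA : A.PosDef) (p q : ℝ) :
    psdPow A p * psdPow A q = psdPow A (p + q) := by
  obtain ⟨U, hU, d, hd, rfl⟩ := exists_spec_posDef hA
  simp only [psdPow_spec hU, spec_mul hU, ← Real.rpow_add (hd _)]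

/-- With the convention `0 ^ p = 0` for `p ≠ 0`, exponents add on the kernel as well unless they
cancel: `0 ^ p * 0 ^ (-p)` is `0`, while `0 ^ 0 = 1`. -/
theorem psdPow_add_of_ne {A : Matrix ι ι ℂ} (hA : A.PosSemidef) {p q : ℝ} (hpq : p + q ≠ 0) :
    psdPow A p * psdPow A q = psdPow A (p + q) := by
  obtain ⟨U, hU, d, hd, rfl⟩ := exists_spec_posSemidef hA
  simp only [psdPow_spec hU, spec_mul hU, ← Real.rpow_add' (hd _) hpq]

theorem psdPow_zero {A : Matrix ι ι ℂ} (hA : A.IsHermitian) : psdPow A 0 = 1 := by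
  obtain ⟨U, hU, h, -⟩ := exists_spec hA
  rw [h, psdPow_spec hU]
  simp [spec_const hU]

theorem psdPow_one {A : Matrix ι ι ℂ} (hA : A.IsHermitian) : psdPow A 1 = A := by
  obtain ⟨U, hU, h, -⟩ := exists_spec hA
  rw [h, psdPow_spec hU]
  simp

theorem psdPow_psdPow {A : Matrix ι ι ℂ} (hA : A.PosSemidef) (p q : ℝ) :
    psdPow (psdPow A p) q = psdPow A (p * q) := by
  obtain ⟨U, hU, d, hd, rfl⟩ := exists_spec_posSemidef hA
  simp only [psdPow_spec hU, Real.rpow_mul (hd _)]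

theorem psdPow_half_mul_half {A : Matrix ι ι ℂ} (hA : A.PosSemidef) :
    psdPow A (1 / 2) * psdPow A (1 / 2) = A := by
  rw [psdPow_add_of_ne hA (by norm_num), add_halves, psdPow_one hA.1]

theorem psdPow_mul_neg {A : Matrix ι ι ℂ} (hA : A.PosDef) (p : ℝ) :
    psdPow A p * psdPow A (-p) = 1 := by
  rw [psdPow_add hA, add_neg_cancel, psdPow_zero hA.1]

theorem psdPow_neg_mul {A : Matrix ι ι ℂ} (hA : A.PosDef) (p : ℝ) :
    psdPow A (-p) * psdPow A p = 1 := by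
  rw [psdPow_add hA, neg_add_cancel, psdPow_zero hA.1]

theorem psdPow_unitary_conj {A : Matrix ι ι ℂ} (hA : A.IsHermitian) {U : Matrix ι ι ℂ}
    (hU : U ∈ Matrix.unitaryGroup ι ℂ) (p : ℝ) :
    psdPow (U * A * Uᴴ) p = U * psdPow A p * Uᴴ := by
  have h := psdPow_intertwine (Matrix.isHermitian_mul_mul_conjTranspose U hA) hA (K := U)
    (by rw [Matrix.mul_assoc, unitary_conjTranspose_mul hU, Matrix.mul_one]) p
  rw [← h, Matrix.mul_assoc (psdPow _ _), unitary_mul_conjTranspose hU, Matrix.mul_one]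

end SpectralForm

/-! ### Loewner order and operator monotonicity of powers -/

section Loewner

variable {ι κ : Type*} [Fintype ι] [DecidableEq ι] [Fintype κ] [DecidableEq κ]
  {A B C : Matrix ι ι ℂ}

theorem LoewnerLE.refl (A : Matrix ι ι ℂ) : LoewnerLE A A := by
  simpa [LoewnerLE] using Matrix.PosSemidef.zero

theorem LoewnerLE.trans (h : LoewnerLE A B) (h' : LoewnerLE B C) : LoewnerLE A C := by
  have := Matrix.PosSemidef.add h' h
  rwa [sub_add_sub_cancel] at this

theorem LoewnerLE.conj (h : LoewnerLE A B) (K : Matrix κ ι ℂ) :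
    LoewnerLE (K * A * Kᴴ) (K * B * Kᴴ) := by
  have := Matrix.PosSemidef.mul_mul_conjTranspose_same h K
  rwa [Matrix.mul_sub, Matrix.sub_mul] at this

theorem LoewnerLE.trace_le (h : LoewnerLE A B) : A.trace.re ≤ B.trace.re := by
  have := (Complex.le_def.1 (Matrix.PosSemidef.trace_nonneg h)).1
  rw [Matrix.trace_sub] at this
  simpa using this

open scoped MatrixOrder Matrix.Norms.L2Operator in
theorem psdPow_mono {p : ℝ} (hp0 : 0 < p) (hp1 : p ≤ 1) (hA : A.PosSemidef)
    (h : LoewnerLE A B) : LoewnerLE (psdPow A p) (psdPow B p) := by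
  have hB : B.PosSemidef := by simpa using Matrix.PosSemidef.add h hA
  have hA' : 0 ≤ A := Matrix.nonneg_iff_posSemidef.2 hA
  have hB' : 0 ≤ B := Matrix.nonneg_iff_posSemidef.2 hB
  have := CFC.rpow_le_rpow (p := p) ⟨hp0.le, hp1⟩ (show A ≤ B from h)
  rw [CFC.rpow_eq_cfc_real hA', CFC.rpow_eq_cfc_real hB'] at this
  exact this

end Loewner

/-! ### Geometric means of positive definite matrices -/

section GeomMeanPos

variable {ι κ : Type*} [Fintype ι] [DecidableEq ι] [Fintype κ] [DecidableEq κ]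
  {A B C D K : Matrix ι ι ℂ} {β : ℝ}

/-- The matrix `A^{-1/2} S` is unitary, so `S` differs from `A^{1/2}` by a unitary on the right,
which functional calculus absorbs. This freedom of factorization is what makes the mean covariant
under invertible congruences. -/
theorem geomMeanPos_eq_of_factor {S T : Matrix ι ι ℂ} (hA : A.PosDef) (hB : B.IsHermitian)
    (hS : A = S * Sᴴ) (hST : S * T = 1) (β : ℝ) :
    geomMeanPos β A B = S * psdPow (T * B * Tᴴ) β * Sᴴ := by
  set P := psdPow A (1 / 2) with hP
  set Q := psdPow A (-(1 / 2)) with hQ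
  have hPH : Pᴴ = P := psdPow_conjTranspose _ _
  have hQH : Qᴴ = Q := psdPow_conjTranspose _ _
  have hPQ : P * Q = 1 := psdPow_mul_neg hA _
  have hQP : Q * P = 1 := psdPow_neg_mul hA _
  have hPP : P * P = A := psdPow_half_mul_half hA.posSemidef
  have hTS : T * S = 1 := mul_eq_one_comm.1 hST
  set V := Q * S with hV
  have hVV : V * Vᴴ = 1 := by
    rw [hV, Matrix.conjTranspose_mul, hQH, Matrix.mul_assoc, ← Matrix.mul_assoc S, ← hS, ← hPP,
      Matrix.mul_assoc P, hPQ, Matrix.mul_one, hQP]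
  have hVV' : Vᴴ * V = 1 := mul_eq_one_comm.1 hVV
  have hVu : Vᴴ ∈ Matrix.unitaryGroup ι ℂ := by
    rw [Matrix.mem_unitaryGroup_iff, Matrix.star_eq_conjTranspose, Matrix.conjTranspose_conjTranspose]
    exact hVV'
  have hSV : S = P * V := by rw [hV, ← Matrix.mul_assoc, hPQ, Matrix.one_mul]
  have hT : T = Vᴴ * Q := by
    have : Vᴴ * Q * S = 1 := by rw [Matrix.mul_assoc]; exact hVV'
    calc T = (Vᴴ * Q * S) * T := by rw [this, Matrix.one_mul]
      _ = Vᴴ * Q := by rw [Matrix.mul_assoc, hST, Matrix.mul_one]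
  have hTB : T * B * Tᴴ = Vᴴ * (Q * B * Q) * Vᴴᴴ := by
    have hTH : Tᴴ = Q * V := by
      rw [hT, Matrix.conjTranspose_mul, hQH, Matrix.conjTranspose_conjTranspose]
    rw [hTH, hT, Matrix.conjTranspose_conjTranspose]; simp only [Matrix.mul_assoc]
  have hHerm : (Q * B * Q).IsHermitian := by
    have := Matrix.isHermitian_mul_mul_conjTranspose Q hB
    rwa [hQH] at this
  have hSH : Sᴴ = Vᴴ * P := by rw [hSV, Matrix.conjTranspose_mul, hPH]
  rw [hTB, psdPow_unitary_conj hHerm hVu, hSH, hSV, Matrix.conjTranspose_conjTranspose]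
  calc geomMeanPos β A B = P * psdPow (Q * B * Q) β * P := rfl
    _ = P * (V * Vᴴ) * psdPow (Q * B * Q) β * (V * Vᴴ) * P := by rw [hVV]; simp
    _ = _ := by simp only [Matrix.mul_assoc]

theorem geomMeanPos_congr (hA : A.PosDef) (hB : B.IsHermitian) (hK : IsUnit K) (β : ℝ) :
    geomMeanPos β (K * A * Kᴴ) (K * B * Kᴴ) = K * geomMeanPos β A B * Kᴴ := by
  obtain ⟨L, hL⟩ := hK.exists_right_inv
  have hL' : L * K = 1 := mul_eq_one_comm.1 hL
  have hKA : (K * A * Kᴴ).PosDef := (Matrix.IsUnit.posDef_star_right_conjugate_iff hK).2 hA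
  have hKB : (K * B * Kᴴ).IsHermitian := Matrix.isHermitian_mul_mul_conjTranspose K hB
  have hPP := psdPow_half_mul_half hA.posSemidef
  have hPQ := psdPow_mul_neg hA (1 / 2)
  have hPH := psdPow_conjTranspose A (1 / 2)
  have hQH := psdPow_conjTranspose A (-(1 / 2))
  have hLK' : Kᴴ * Lᴴ = 1 := by rw [← Matrix.conjTranspose_mul, hL', Matrix.conjTranspose_one]
  rw [geomMeanPos_eq_of_factor (S := K * psdPow A (1 / 2)) (T := psdPow A (-(1 / 2)) * L) hKA hKB]
  · have : psdPow A (-(1 / 2)) * L * (K * B * Kᴴ) * (psdPow A (-(1 / 2)) * L)ᴴ =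
        psdPow A (-(1 / 2)) * B * psdPow A (-(1 / 2)) := by
      rw [Matrix.conjTranspose_mul, hQH]
      calc _ = psdPow A (-(1 / 2)) * (L * K) * B * (Kᴴ * Lᴴ) * psdPow A (-(1 / 2)) := by
            simp only [Matrix.mul_assoc]
        _ = _ := by rw [hL', hLK']; simp
    rw [this, Matrix.conjTranspose_mul, hPH, geomMeanPos]
    simp only [Matrix.mul_assoc]
  · rw [Matrix.conjTranspose_mul, hPH]
    conv_lhs => rw [← hPP]
    simp only [Matrix.mul_assoc]
  · rw [Matrix.mul_assoc, ← Matrix.mul_assoc (psdPow A _), hPQ, Matrix.one_mul, hL]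

theorem geomMeanPos_posSemidef (A : Matrix ι ι ℂ) (hB : B.PosSemidef) (β : ℝ) :
    (geomMeanPos β A B).PosSemidef := by
  have h1 := hB.mul_mul_conjTranspose_same (psdPow A (-(1 / 2)))
  rw [psdPow_conjTranspose] at h1
  have := (psdPow_posSemidef h1 β).mul_mul_conjTranspose_same (psdPow A (1 / 2))
  rwa [psdPow_conjTranspose] at this

theorem geomMeanPos_mono_right (hβ0 : 0 < β) (hβ1 : β ≤ 1) (A : Matrix ι ι ℂ) (hB : B.PosSemidef)
    (h : LoewnerLE B C) : LoewnerLE (geomMeanPos β A B) (geomMeanPos β A C) := by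
  have h1 := h.conj (psdPow A (-(1 / 2)))
  have h2 := hB.mul_mul_conjTranspose_same (psdPow A (-(1 / 2)))
  rw [psdPow_conjTranspose] at h1 h2
  have h3 := (psdPow_mono hβ0 hβ1 h2 h1).conj (psdPow A (1 / 2))
  rwa [psdPow_conjTranspose] at h3

/-- With `X = A^{-1/2} B^{1/2}`, the relation `(X Xᴴ)^β X = X (Xᴴ X)^β` moves the power to the other
side, and `Xᴴ X` is the inverse of `B^{-1/2} A B^{-1/2}`. It turns monotonicity in the right
argument into monotonicity in the left one. -/
theorem geomMeanPos_swap (hA : A.PosDef) (hB : B.PosDef) (β : ℝ) :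
    geomMeanPos β A B = geomMeanPos (1 - β) B A := by
  set P := psdPow A (1 / 2) with hP
  set Q := psdPow A (-(1 / 2)) with hQ
  set R := psdPow B (1 / 2) with hR
  set S := psdPow B (-(1 / 2)) with hS
  have hQH : Qᴴ = Q := psdPow_conjTranspose _ _
  have hRH : Rᴴ = R := psdPow_conjTranspose _ _
  have hSH : Sᴴ = S := psdPow_conjTranspose _ _
  have hPQ : P * Q = 1 := psdPow_mul_neg hA _
  have hQP : Q * P = 1 := psdPow_neg_mul hA _
  have hRS : R * S = 1 := psdPow_mul_neg hB _
  have hSR : S * R = 1 := psdPow_neg_mul hB _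
  have hPP : P * P = A := psdPow_half_mul_half hA.posSemidef
  have hRR : R * R = B := psdPow_half_mul_half hB.posSemidef
  set X := Q * R with hX
  set G := Xᴴ * X with hG
  set H := S * A * S with hH
  have hHpd : H.PosDef := by
    have : IsUnit S := IsUnit.of_mul_eq_one _ hSR
    have h := (Matrix.IsUnit.posDef_star_right_conjugate_iff this).2 hA
    rwa [Matrix.star_eq_conjTranspose, hSH] at h
  have hXX : X * Xᴴ = Q * B * Q := by
    rw [hX, Matrix.conjTranspose_mul, hQH, hRH, ← hRR]; simp only [Matrix.mul_assoc]
  have hGH : G * H = 1 := by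
    rw [hG, hX, Matrix.conjTranspose_mul, hQH, hRH, hH, ← hPP]
    calc R * Q * (Q * R) * (S * (P * P) * S) = R * Q * Q * (R * S) * P * P * S := by
          simp only [Matrix.mul_assoc]
      _ = R * Q * (Q * P) * P * S := by rw [hRS]; simp only [Matrix.mul_assoc, Matrix.one_mul]
      _ = R * (Q * P) * S := by conv_lhs => rw [hQP, Matrix.mul_one, Matrix.mul_assoc R]
      _ = 1 := by rw [hQP, Matrix.mul_one, hRS]
  have hGpow : psdPow G β = psdPow H (-β) := by
    have : G = psdPow H (-1) := by
      have h1 := psdPow_mul_neg hHpd 1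
      rw [psdPow_one hHpd.1] at h1
      calc G = G * (H * psdPow H (-1)) := by rw [h1, Matrix.mul_one]
        _ = psdPow H (-1) := by rw [← Matrix.mul_assoc, hGH, Matrix.one_mul]
    rw [this, psdPow_psdPow hHpd.posSemidef, neg_one_mul]
  have hint : psdPow (X * Xᴴ) β * X = X * psdPow G β :=
    psdPow_intertwine (Matrix.isHermitian_mul_conjTranspose_self X)
      (Matrix.isHermitian_conjTranspose_mul_self X) (by rw [Matrix.mul_assoc]) β
  have hXinv : X * (S * P) = 1 := by
    rw [hX, Matrix.mul_assoc, ← Matrix.mul_assoc R, hRS, Matrix.one_mul, hQP]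
  have hHpow : psdPow H (-β) * H = psdPow H (1 - β) := by
    conv_lhs => rw [← psdPow_one hHpd.1, psdPow_psdPow hHpd.posSemidef, psdPow_add hHpd]
    congr 1; ring
  calc geomMeanPos β A B = P * psdPow (X * Xᴴ) β * P := by rw [hXX]; rfl
    _ = P * (psdPow (X * Xᴴ) β * X) * (S * P) * P := by
        rw [Matrix.mul_assoc P _ (S * P), Matrix.mul_assoc _ X, hXinv, Matrix.mul_one]
    _ = P * (Q * R) * psdPow H (-β) * S * (P * P) := by
        rw [hint, hGpow]; simp only [hX, Matrix.mul_assoc]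
    _ = R * psdPow H (-β) * S * A * (S * R) := by
        rw [← Matrix.mul_assoc P, hPQ, Matrix.one_mul, hPP, hSR, Matrix.mul_one]
    _ = R * (psdPow H (-β) * H) * R := by simp only [hH, Matrix.mul_assoc]
    _ = geomMeanPos (1 - β) B A := by rw [hHpow]; rfl

theorem LoewnerLE.posDef (hA : A.PosDef) (h : LoewnerLE A B) : B.PosDef := by
  simpa using Matrix.PosDef.posSemidef_add h hA

theorem LoewnerLE.posSemidef (hA : A.PosSemidef) (h : LoewnerLE A B) : B.PosSemidef := by
  simpa using Matrix.PosSemidef.add h hA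

theorem geomMeanPos_mono (hβ0 : 0 < β) (hβ1 : β < 1) (hA : A.PosDef) (hB : B.PosDef)
    (hAC : LoewnerLE A C) (hBD : LoewnerLE B D) :
    LoewnerLE (geomMeanPos β A B) (geomMeanPos β C D) := by
  have hD := hBD.posDef hB
  have hC := hAC.posDef hA
  refine (geomMeanPos_mono_right hβ0 hβ1.le A hB.posSemidef hBD).trans ?_
  rw [geomMeanPos_swap hA hD, geomMeanPos_swap hC hD]
  exact geomMeanPos_mono_right (by linarith) (by linarith) D hA.posSemidef hAC

theorem geomMeanPos_spec {U : Matrix ι ι ℂ} (hU : U ∈ Matrix.unitaryGroup ι ℂ) {a b : ι → ℝ}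
    (ha : ∀ i, 0 < a i) (hb : ∀ i, 0 < b i) (β : ℝ) :
    geomMeanPos β (spec U a) (spec U b) = spec U fun i => a i ^ (1 - β) * b i ^ β := by
  simp only [geomMeanPos, psdPow_spec hU, spec_mul hU]
  congr 1
  ext i
  have h1 : (a i ^ (-(1 / 2 : ℝ)) * b i * a i ^ (-(1 / 2 : ℝ))) = a i ^ (-1 : ℝ) * b i := by
    rw [mul_right_comm, ← Real.rpow_add (ha i)]; norm_num
  rw [h1, Real.mul_rpow (Real.rpow_nonneg (ha i).le _) (hb i).le, ← Real.rpow_mul (ha i).le]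
  rw [show a i ^ (1 / 2 : ℝ) * (a i ^ (-1 * β) * b i ^ β) * a i ^ (1 / 2 : ℝ) =
    a i ^ (1 / 2 : ℝ) * a i ^ (-1 * β) * a i ^ (1 / 2 : ℝ) * b i ^ β by ring,
    ← Real.rpow_add (ha i), ← Real.rpow_add (ha i)]
  congr 2; ring

end GeomMeanPos

/-! ### Limits in the Loewner order -/

section Limits

open Filter

variable {ι κ : Type*} [Fintype ι] [DecidableEq ι] [Fintype κ] [DecidableEq κ]

theorem posSemidef_of_tendsto {α : Type*} {l : Filter α} [l.NeBot] {f : α → Matrix ι ι ℂ}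
    {M : Matrix ι ι ℂ} (hf : Tendsto f l (𝓝 M)) (h : ∀ᶠ x in l, (f x).PosSemidef) :
    M.PosSemidef := by
  refine Matrix.PosSemidef.of_dotProduct_mulVec_nonneg ?_ fun x => ?_
  · have h1 : Tendsto (fun a => (f a)ᴴ) l (𝓝 Mᴴ) :=
      (Continuous.matrix_conjTranspose continuous_id).continuousAt.tendsto.comp hf
    refine tendsto_nhds_unique (h1.congr' ?_) hf
    filter_upwards [h] with a ha using ha.1
  · have hc : Continuous fun N : Matrix ι ι ℂ => star x ⬝ᵥ N *ᵥ x :=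
      continuous_const.dotProduct (Continuous.matrix_mulVec continuous_id continuous_const)
    refine ge_of_tendsto (hc.continuousAt.tendsto.comp hf) ?_
    filter_upwards [h] with a ha using ha.dotProduct_mulVec_nonneg x

theorem LoewnerLE.of_tendsto {α : Type*} {l : Filter α} [l.NeBot] {f g : α → Matrix ι ι ℂ}
    {M N : Matrix ι ι ℂ} (hf : Tendsto f l (𝓝 M)) (hg : Tendsto g l (𝓝 N))
    (h : ∀ᶠ x in l, LoewnerLE (f x) (g x)) : LoewnerLE M N :=
  posSemidef_of_tendsto (hg.sub hf) h

theorem tendsto_spec {α : Type*} {l : Filter α} (U : Matrix ι ι ℂ) {d : α → ι → ℝ} {e : ι → ℝ}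
    (h : ∀ i, Tendsto (fun a => d a i) l (𝓝 (e i))) :
    Tendsto (fun a => spec U (d a)) l (𝓝 (spec U e)) := by
  have hc : Continuous fun d : ι → ℝ => spec U d := by
    unfold spec
    exact (continuous_const.matrix_mul (Continuous.matrix_diagonal (by fun_prop))).matrix_mul
      continuous_const
  exact hc.continuousAt.tendsto.comp (tendsto_pi_nhds.2 h)

/-- Polarization: the entries are finite combinations of values of the quadratic form, so
convergence of the form implies convergence of the matrix. -/
theorem entry_eq_of_isHermitian {M : Matrix ι ι ℂ} (hM : M.IsHermitian) (i j : ι) :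
    let q : (ι → ℂ) → ℝ := fun x => (star x ⬝ᵥ M *ᵥ x).re
    let u : ι → ℂ := Pi.single i 1
    let v : ι → ℂ := Pi.single j 1
    let w : ι → ℂ := Pi.single j (-Complex.I)
    M i j = (((q (u + v) - q u - q v) / 2 : ℝ) : ℂ) +
      (((q (u + w) - q u - q w) / 2 : ℝ) : ℂ) * Complex.I := by
  intro q u v w
  have hij : M j i = star (M i j) := by
    conv_lhs => rw [← hM]
    rfl
  have hq : ∀ x y, q (x + y) - q x - q y = (star x ⬝ᵥ M *ᵥ y).re + (star y ⬝ᵥ M *ᵥ x).re := by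
    intro x y
    simp only [q, star_add, Matrix.mulVec_add, add_dotProduct, dotProduct_add, Complex.add_re]
    ring
  rw [hq, hq]
  have e1 : star u ⬝ᵥ M *ᵥ v = M i j := by simp [u, v]
  have e2 : star v ⬝ᵥ M *ᵥ u = star (M i j) := by simp [u, v, hij]
  have e3 : star u ⬝ᵥ M *ᵥ w = -Complex.I * M i j := by
    simp [u, w]
  have e4 : star w ⬝ᵥ M *ᵥ u = Complex.I * star (M i j) := by
    simp [u, w, hij]
  rw [e1, e2, e3, e4]
  apply Complex.ext <;> simp

/-- Each quadratic form is monotone in `ε` and bounded below by `0`, hence has a right limit at `0`;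
polarization assembles these limits into a matrix. -/
theorem exists_tendsto_of_loewner_monotone {f : ℝ → Matrix ι ι ℂ}
    (hpos : ∀ ε, 0 < ε → (f ε).PosSemidef)
    (hmono : ∀ ε δ, 0 < ε → ε ≤ δ → LoewnerLE (f ε) (f δ)) :
    ∃ L, Tendsto f (𝓝[>] (0 : ℝ)) (𝓝 L) := by
  have hq : ∀ x : ι → ℂ, ∃ c : ℝ,
      Tendsto (fun ε => (star x ⬝ᵥ f ε *ᵥ x).re) (𝓝[>] (0 : ℝ)) (𝓝 c) := by
    intro x
    refine ⟨_, MonotoneOn.tendsto_nhdsGT (f := fun ε => (star x ⬝ᵥ f ε *ᵥ x).re) ?_ ?_⟩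
    · intro a ha b _ hab
      have := (Complex.le_def.1 ((hmono a b ha hab).dotProduct_mulVec_nonneg x)).1
      simpa [Matrix.sub_mulVec] using this
    · refine ⟨0, ?_⟩
      rintro _ ⟨a, ha, rfl⟩
      exact (Complex.le_def.1 ((hpos a ha).dotProduct_mulVec_nonneg x)).1
  choose c hc using hq
  have hent : ∀ i j, ∃ z, Tendsto (fun ε => f ε i j) (𝓝[>] (0 : ℝ)) (𝓝 z) := by
    intro i j
    have h := ((Complex.continuous_ofReal.tendsto _).comp
      ((((hc (Pi.single i 1 + Pi.single j 1)).sub (hc (Pi.single i 1))).sub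
        (hc (Pi.single j 1))).div_const 2)).add
      (((Complex.continuous_ofReal.tendsto _).comp
        ((((hc (Pi.single i 1 + Pi.single j (-Complex.I))).sub (hc (Pi.single i 1))).sub
          (hc (Pi.single j (-Complex.I)))).div_const 2)).mul_const Complex.I)
    refine ⟨_, h.congr' ?_⟩
    filter_upwards [self_mem_nhdsWithin] with ε hε
    exact (entry_eq_of_isHermitian (hpos ε hε).1 i j).symm
  choose z hz using hent
  exact ⟨Matrix.of z, tendsto_pi_nhds.2 fun i => tendsto_pi_nhds.2 fun j => hz i j⟩

open scoped MatrixOrder Matrix.Norms.L2Operator in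
theorem IsHermitian.loewnerLE_norm_smul_one {M : Matrix ι ι ℂ} (hM : M.IsHermitian) :
    LoewnerLE M ((‖M‖ : ℂ) • (1 : Matrix ι ι ℂ)) := by
  have h : M ≤ algebraMap ℝ (Matrix ι ι ℂ) ‖M‖ := IsSelfAdjoint.le_algebraMap_norm_self hM
  have e : algebraMap ℝ (Matrix ι ι ℂ) ‖M‖ = (‖M‖ : ℂ) • (1 : Matrix ι ι ℂ) := by
    rw [Algebra.algebraMap_eq_smul_one]
    ext i j; simp [Matrix.smul_apply]
  rw [e] at h
  exact h

theorem loewnerLE_smul_one {a b : ℝ} (h : a ≤ b) :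
    LoewnerLE ((a : ℂ) • (1 : Matrix ι ι ℂ)) ((b : ℂ) • 1) := by
  rw [LoewnerLE, ← sub_smul]
  exact Matrix.PosSemidef.one.smul (by rw [← Complex.ofReal_sub]; exact_mod_cast sub_nonneg.2 h)

theorem LoewnerLE.add_left {A B : Matrix ι ι ℂ} (C : Matrix ι ι ℂ) (h : LoewnerLE A B) :
    LoewnerLE (C + A) (C + B) := by
  rw [LoewnerLE] at *; rwa [add_sub_add_left_eq_sub]

open scoped Matrix.Norms.L2Operator in
theorem eventually_loewnerLE_add {α : Type*} {l : Filter α} {f : α → Matrix ι ι ℂ}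
    {M : Matrix ι ι ℂ} (hf : Tendsto f l (𝓝 M)) (hH : ∀ a, (f a).IsHermitian)
    (hM : M.IsHermitian) {η : ℝ} (hη : 0 < η) :
    ∀ᶠ a in l, LoewnerLE (f a) (M + (η : ℂ) • 1) := by
  have h0 : Tendsto (fun a => ‖f a - M‖) l (𝓝 0) := by
    have h1 := (hf.sub_const M)
    rw [sub_self] at h1
    have := (continuous_norm (E := Matrix ι ι ℂ)).continuousAt.tendsto.comp h1
    rw [norm_zero] at this
    exact this
  filter_upwards [h0.eventually (gt_mem_nhds hη)] with a ha
  have h1 := (IsHermitian.loewnerLE_norm_smul_one ((hH a).sub hM)).trans (loewnerLE_smul_one ha.le)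
  have := h1.add_left M
  rwa [add_sub_cancel] at this

theorem eventually_isUnit_add_smul_one (K : Matrix ι ι ℂ) :
    ∀ᶠ δ : ℝ in 𝓝[>] 0, IsUnit (K + (δ : ℂ) • 1) := by
  have hfin : (spectrum ℂ K).Finite := Matrix.finite_spectrum K
  have hT : {δ : ℝ | ¬ IsUnit (K + (δ : ℂ) • 1)}.Finite := by
    refine Set.Finite.subset (hfin.preimage (f := fun δ : ℝ => -(δ : ℂ)) ?_) ?_
    · intro a _ b _ h; simpa using h
    · intro δ hδ
      simp only [Set.mem_preimage, spectrum.mem_iff]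
      intro h
      apply hδ
      have h2 := h.neg
      convert h2 using 1
      rw [Algebra.algebraMap_eq_smul_one]
      simp
  -- Zero is taken out of the exceptional set because `K` itself may be singular; what remains is
  -- finite and misses `0`.
  have h2 : ({δ : ℝ | ¬ IsUnit (K + (δ : ℂ) • 1)} \ {0})ᶜ ∈ 𝓝 (0 : ℝ) :=
    (hT.subset Set.sdiff_subset).isClosed.isOpen_compl.mem_nhds (by simp)
  filter_upwards [mem_nhdsWithin_of_mem_nhds h2, self_mem_nhdsWithin] with δ hδ hδ0
  by_contra h
  exact hδ ⟨h, (ne_of_gt hδ0 : δ ≠ 0)⟩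

theorem posDef_add_smul_one {A : Matrix ι ι ℂ} (hA : A.PosSemidef) {ε : ℝ} (hε : 0 < ε) :
    (A + (ε : ℂ) • (1 : Matrix ι ι ℂ)).PosDef :=
  Matrix.PosDef.posSemidef_add hA (Matrix.PosDef.one.smul (by exact_mod_cast hε))

theorem tendsto_add_smul_one (A : Matrix ι ι ℂ) :
    Tendsto (fun ε : ℝ => A + (ε : ℂ) • (1 : Matrix ι ι ℂ)) (𝓝[>] 0) (𝓝 A) := by
  have hc : Continuous fun ε : ℝ => A + (ε : ℂ) • (1 : Matrix ι ι ℂ) := by fun_prop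
  have := hc.tendsto 0
  simp only [Complex.ofReal_zero, zero_smul, add_zero] at this
  exact this.mono_left nhdsWithin_le_nhds

end Limits

/-! ### Geometric means of positive semidefinite matrices -/

section GeomMean

open Filter

variable {ι κ : Type*} [Fintype ι] [DecidableEq ι] [Fintype κ] [DecidableEq κ]
  {A B C : Matrix ι ι ℂ} {β : ℝ}

theorem geomMeanPos_add_mono (hβ0 : 0 < β) (hβ1 : β < 1) (hA : A.PosSemidef) (hB : B.PosSemidef)
    {ε δ : ℝ} (hε : 0 < ε) (h : ε ≤ δ) :
    LoewnerLE (geomMeanPos β (A + (ε : ℂ) • 1) (B + (ε : ℂ) • 1))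
      (geomMeanPos β (A + (δ : ℂ) • 1) (B + (δ : ℂ) • 1)) :=
  geomMeanPos_mono hβ0 hβ1 (posDef_add_smul_one hA hε) (posDef_add_smul_one hB hε)
    ((loewnerLE_smul_one h).add_left A) ((loewnerLE_smul_one h).add_left B)

theorem tendsto_geomMean (hβ0 : 0 < β) (hβ1 : β < 1) (hA : A.PosSemidef) (hB : B.PosSemidef) :
    Tendsto (fun ε : ℝ => geomMeanPos β (A + (ε : ℂ) • 1) (B + (ε : ℂ) • 1)) (𝓝[>] 0)
      (𝓝 (geomMean β A B)) :=
  tendsto_nhds_limUnder (exists_tendsto_of_loewner_monotone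
    (fun _ hε => geomMeanPos_posSemidef _ (posDef_add_smul_one hB hε).posSemidef β)
    (fun _ _ hε h => geomMeanPos_add_mono hβ0 hβ1 hA hB hε h))

theorem geomMean_le_geomMeanPos (hβ0 : 0 < β) (hβ1 : β < 1) (hA : A.PosSemidef)
    (hB : B.PosSemidef) {ε : ℝ} (hε : 0 < ε) :
    LoewnerLE (geomMean β A B) (geomMeanPos β (A + (ε : ℂ) • 1) (B + (ε : ℂ) • 1)) := by
  refine LoewnerLE.of_tendsto (tendsto_geomMean hβ0 hβ1 hA hB) tendsto_const_nhds ?_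
  filter_upwards [Ioo_mem_nhdsGT hε] with δ hδ
  exact geomMeanPos_add_mono hβ0 hβ1 hA hB hδ.1 hδ.2.le

theorem le_geomMean (hβ0 : 0 < β) (hβ1 : β < 1) (hA : A.PosSemidef) (hB : B.PosSemidef)
    (h : ∀ ε : ℝ, 0 < ε → LoewnerLE C (geomMeanPos β (A + (ε : ℂ) • 1) (B + (ε : ℂ) • 1))) :
    LoewnerLE C (geomMean β A B) := by
  refine LoewnerLE.of_tendsto tendsto_const_nhds (tendsto_geomMean hβ0 hβ1 hA hB) ?_
  filter_upwards [self_mem_nhdsWithin] with ε hε using h ε hε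

/-- For invertible `K` the positive definite mean is covariant. In general `K` is perturbed to `K +
ε`, with a regularization `η` of the right side held fixed: the perturbed congruences are eventually
below `K A Kᴴ + η` and `K B Kᴴ + η`, so monotonicity applies before `ε` tends to `0`. -/
theorem conj_geomMean_le (hβ0 : 0 < β) (hβ1 : β < 1) (hA : A.PosSemidef) (hB : B.PosSemidef)
    (K : Matrix ι ι ℂ) :
    LoewnerLE (K * geomMean β A B * Kᴴ) (geomMean β (K * A * Kᴴ) (K * B * Kᴴ)) := by
  have hKA := hA.mul_mul_conjTranspose_same K
  have hKB := hB.mul_mul_conjTranspose_same K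
  refine le_geomMean hβ0 hβ1 hKA hKB fun η hη => ?_
  have hK := tendsto_add_smul_one K
  have hKH : Tendsto (fun ε : ℝ => (K + (ε : ℂ) • (1 : Matrix ι ι ℂ))ᴴ) (𝓝[>] 0) (𝓝 Kᴴ) :=
    (Continuous.matrix_conjTranspose continuous_id).continuousAt.tendsto.comp hK
  have hlim : Tendsto (fun ε : ℝ => (K + (ε : ℂ) • 1) * geomMean β A B * (K + (ε : ℂ) • 1)ᴴ)
      (𝓝[>] 0) (𝓝 (K * geomMean β A B * Kᴴ)) := (hK.mul tendsto_const_nhds).mul hKH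
  have key : ∀ {A : Matrix ι ι ℂ}, A.PosSemidef → ∀ᶠ ε : ℝ in 𝓝[>] 0,
      LoewnerLE ((K + (ε : ℂ) • 1) * (A + ((ε : ℝ) : ℂ) • 1) * (K + (ε : ℂ) • 1)ᴴ)
        (K * A * Kᴴ + (η : ℂ) • 1) := by
    intro A hA
    refine eventually_loewnerLE_add ((hK.mul (tendsto_add_smul_one A)).mul hKH) (fun ε => ?_)
      (hA.mul_mul_conjTranspose_same K).1 hη
    refine Matrix.isHermitian_mul_mul_conjTranspose _ (hA.1.add ?_)
    rw [Matrix.IsHermitian, Matrix.conjTranspose_smul, Matrix.conjTranspose_one]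
    simp
  refine LoewnerLE.of_tendsto hlim tendsto_const_nhds ?_
  filter_upwards [key hA, key hB, eventually_isUnit_add_smul_one K, self_mem_nhdsWithin]
    with ε h1 h2 h3 hε
  have hAε := posDef_add_smul_one hA hε
  have hBε := posDef_add_smul_one hB hε
  refine ((geomMean_le_geomMeanPos hβ0 hβ1 hA hB hε).conj _).trans ?_
  rw [← geomMeanPos_congr hAε hBε.1 h3]
  exact geomMeanPos_mono hβ0 hβ1 ((Matrix.IsUnit.posDef_star_right_conjugate_iff h3).2 hAε)
    ((Matrix.IsUnit.posDef_star_right_conjugate_iff h3).2 hBε) h1 h2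

theorem spec_add_smul_one {U : Matrix ι ι ℂ} (hU : U ∈ Matrix.unitaryGroup ι ℂ) (d : ι → ℝ)
    (ε : ℝ) : spec U d + (ε : ℂ) • 1 = spec U fun i => d i + ε := by
  rw [← spec_const hU, spec_add]

theorem tendsto_add_nhdsGT_zero (a : ℝ) : Tendsto (fun ε : ℝ => a + ε) (𝓝[>] 0) (𝓝 a) := by
  have hc : Continuous fun ε : ℝ => a + ε := by fun_prop
  have := hc.tendsto 0
  rw [add_zero] at this
  exact this.mono_left nhdsWithin_le_nhds

theorem geomMean_spec (hβ0 : 0 < β) (hβ1 : β < 1) {U : Matrix ι ι ℂ}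
    (hU : U ∈ Matrix.unitaryGroup ι ℂ) {a b : ι → ℝ} (ha : ∀ i, 0 ≤ a i) (hb : ∀ i, 0 ≤ b i) :
    geomMean β (spec U a) (spec U b) = spec U fun i => a i ^ (1 - β) * b i ^ β := by
  refine tendsto_nhds_unique (tendsto_geomMean hβ0 hβ1 (spec_posSemidef U ha) (spec_posSemidef U hb))
    (Tendsto.congr' (f₁ := fun ε : ℝ => spec U fun i => (a i + ε) ^ (1 - β) * (b i + ε) ^ β) ?_ ?_)
  · filter_upwards [self_mem_nhdsWithin] with ε hε
    rw [spec_add_smul_one hU, spec_add_smul_one hU,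
      geomMeanPos_spec hU (fun i => add_pos_of_nonneg_of_pos (ha i) hε)
        (fun i => add_pos_of_nonneg_of_pos (hb i) hε)]
  · refine tendsto_spec U fun i => ?_
    exact ((tendsto_add_nhdsGT_zero (a i)).rpow_const (Or.inr (by linarith))).mul
      ((tendsto_add_nhdsGT_zero (b i)).rpow_const (Or.inr hβ0.le))

/-- Monotonicity replaces `B` by a multiple of the identity, which commutes with `A`, so the mean
becomes explicit. It forces the support of a feasible `ρ` into that of `σ`. -/
theorem geomMean_le_smul_psdPow (hβ0 : 0 < β) (hβ1 : β < 1) (hA : A.PosSemidef)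
    (hB : B.PosSemidef) : ∃ c : ℝ, 0 ≤ c ∧
      LoewnerLE (geomMean β A B) ((c : ℂ) • psdPow A (1 - β)) := by
  obtain ⟨c, hc, hBc⟩ : ∃ c : ℝ, 0 ≤ c ∧ LoewnerLE B ((c : ℂ) • 1) := by
    open scoped Matrix.Norms.L2Operator in
    exact ⟨_, norm_nonneg B, IsHermitian.loewnerLE_norm_smul_one hB.1⟩
  obtain ⟨U, hU, d, hd, rfl⟩ := exists_spec_posSemidef hA
  refine ⟨c ^ β, Real.rpow_nonneg hc β, ?_⟩
  rw [psdPow_spec hU, spec_smul]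
  have e : (spec U fun i => c ^ β * d i ^ (1 - β)) = geomMean β (spec U d) ((c : ℂ) • 1) := by
    rw [← spec_const hU, geomMean_spec hβ0 hβ1 hU hd fun _ => hc]
    simp only [mul_comm]
  rw [e]
  have hc1 : ((c : ℂ) • (1 : Matrix ι ι ℂ)).PosSemidef :=
    Matrix.PosSemidef.one.smul (by exact_mod_cast hc)
  refine LoewnerLE.of_tendsto (tendsto_geomMean hβ0 hβ1 hA hB) (tendsto_geomMean hβ0 hβ1 hA hc1) ?_
  filter_upwards [self_mem_nhdsWithin] with ε hε
  refine geomMeanPos_mono hβ0 hβ1 (posDef_add_smul_one hA hε) (posDef_add_smul_one hB hε)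
    (LoewnerLE.refl _) ?_
  rw [add_comm B, add_comm ((c : ℂ) • 1)]
  exact hBc.add_left _

end GeomMean

/-! ### Supports and support projections -/

section Support

variable {ι κ : Type*} [Fintype ι] [DecidableEq ι] [Fintype κ] [DecidableEq κ]
  {ρ σ : Matrix ι ι ℂ}

theorem psdPow_mul_neg_one_mul {σ : Matrix ι ι ℂ} (hσ : σ.PosSemidef) {p : ℝ} (hp : p ≠ 0) :
    σ * psdPow σ (-1) * psdPow σ p = psdPow σ p := by
  obtain ⟨U, hU, d, hd, rfl⟩ := exists_spec_posSemidef hσ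
  simp only [psdPow_spec hU, spec_mul hU]
  congr 1
  ext i
  rcases (hd i).eq_or_lt with h | h
  · simp [← h, Real.zero_rpow hp]
  · rw [Real.rpow_neg_one, mul_inv_cancel₀ h.ne', one_mul]

/-- Powers are taken on the support, so `σ * psdPow σ (-1)` is the orthogonal projection onto the
range of `σ`. -/
theorem suppLE_iff (hσ : σ.PosSemidef) : SuppLE ρ σ ↔ σ * psdPow σ (-1) * ρ = ρ := by
  constructor
  · intro h
    have hcol : ∀ j, ∃ v, σ *ᵥ v = ρ.col j := by
      intro j
      obtain ⟨v, hv⟩ := h ⟨Pi.single j 1, rfl⟩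
      refine ⟨v, ?_⟩
      simpa using hv
    choose v hv using hcol
    have hZ : ρ = σ * Matrix.of (fun i j => v j i) := by
      ext i j
      have := congrFun (hv j) i
      simp only [Matrix.col_apply] at this
      rw [← this]; rfl
    have h1 := psdPow_mul_neg_one_mul hσ one_ne_zero
    rw [psdPow_one hσ.1] at h1
    conv_lhs => rw [hZ, ← Matrix.mul_assoc, h1, ← hZ]
  · rintro h _ ⟨x, rfl⟩
    refine ⟨(psdPow σ (-1) * ρ) *ᵥ x, ?_⟩
    simp only [Matrix.mulVecLin_apply, Matrix.mulVec_mulVec, ← Matrix.mul_assoc, h]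

theorem mul_eq_zero_of_conj_eq_zero (hρ : ρ.PosSemidef) {Q : Matrix κ ι ℂ}
    (h : Q * ρ * Qᴴ = 0) : Q * ρ = 0 := by
  have h1 := psdPow_half_mul_half hρ
  have h2 : (Q * psdPow ρ (1 / 2)) * (Q * psdPow ρ (1 / 2))ᴴ = 0 := by
    rw [Matrix.conjTranspose_mul, psdPow_conjTranspose, ← h]
    conv_rhs => rw [← h1]
    simp only [Matrix.mul_assoc]
  have h3 := Matrix.self_mul_conjTranspose_eq_zero.1 h2
  rw [← h1, ← Matrix.mul_assoc, h3, Matrix.zero_mul]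

theorem suppLE_of_loewnerLE_psdPow (hρ : ρ.PosSemidef) (hσ : σ.PosSemidef) {c p : ℝ}
    (hp : p ≠ 0) (h : LoewnerLE ρ ((c : ℂ) • psdPow σ p)) : SuppLE ρ σ := by
  rw [suppLE_iff hσ]
  set Q := 1 - σ * psdPow σ (-1) with hQ
  have hQσ : Q * psdPow σ p = 0 := by
    rw [hQ, Matrix.sub_mul, psdPow_mul_neg_one_mul hσ hp, Matrix.one_mul, sub_self]
  have h1 := h.conj Q
  rw [Matrix.mul_smul, hQσ, smul_zero, Matrix.zero_mul] at h1
  have h2 := hρ.mul_mul_conjTranspose_same Q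
  have h3 : Q * ρ * Qᴴ = 0 := by
    open scoped MatrixOrder in
    exact le_antisymm (show Q * ρ * Qᴴ ≤ 0 from h1) (Matrix.nonneg_iff_posSemidef.2 h2)
  have h4 := mul_eq_zero_of_conj_eq_zero hρ h3
  rw [hQ, Matrix.sub_mul, Matrix.one_mul, sub_eq_zero] at h4
  exact h4.symm

end Support

/-! ### Hilbert–Schmidt norm and Cauchy–Schwarz for the trace -/

section HilbertSchmidt

variable {ι : Type*} [Fintype ι] [DecidableEq ι]

/-- The squared Hilbert–Schmidt norm. -/
def hsSq (M : Matrix ι ι ℂ) : ℝ := ∑ i, ∑ j, ‖M i j‖ ^ 2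

theorem hsSq_nonneg (M : Matrix ι ι ℂ) : 0 ≤ hsSq M :=
  Finset.sum_nonneg fun _ _ => Finset.sum_nonneg fun _ _ => sq_nonneg _

theorem hsSq_eq_trace (M : Matrix ι ι ℂ) : ((hsSq M : ℝ) : ℂ) = (M * Mᴴ).trace := by
  simp only [hsSq, Matrix.trace, Matrix.diag_apply, Matrix.mul_apply, Matrix.conjTranspose_apply]
  push_cast
  refine Finset.sum_congr rfl fun i _ => Finset.sum_congr rfl fun j _ => ?_
  rw [← Complex.mul_conj']
  rfl

theorem hsSq_eq_trace' (M : Matrix ι ι ℂ) : ((hsSq M : ℝ) : ℂ) = (Mᴴ * M).trace := by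
  rw [hsSq_eq_trace, Matrix.trace_mul_comm]

theorem hsSq_mul_unitary (M : Matrix ι ι ℂ) {U : Matrix ι ι ℂ}
    (hU : U ∈ Matrix.unitaryGroup ι ℂ) : hsSq (M * U) = hsSq M := by
  apply Complex.ofReal_injective
  rw [hsSq_eq_trace, hsSq_eq_trace, Matrix.conjTranspose_mul, Matrix.mul_assoc,
    ← Matrix.mul_assoc U, unitary_mul_conjTranspose hU, Matrix.one_mul]

theorem hsSq_unitary_mul (M : Matrix ι ι ℂ) {U : Matrix ι ι ℂ}
    (hU : U ∈ Matrix.unitaryGroup ι ℂ) : hsSq (U * M) = hsSq M := by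
  apply Complex.ofReal_injective
  rw [hsSq_eq_trace', hsSq_eq_trace', Matrix.conjTranspose_mul, Matrix.mul_assoc,
    ← Matrix.mul_assoc Uᴴ, unitary_conjTranspose_mul hU, Matrix.one_mul]

theorem norm_trace_mul_le (M N : Matrix ι ι ℂ) :
    ‖(M * N).trace‖ ≤ √(hsSq M) * √(hsSq N) := by
  have h1 : (M * N).trace = ∑ p : ι × ι, M p.1 p.2 * N p.2 p.1 := by
    simp only [Matrix.trace, Matrix.diag_apply, Matrix.mul_apply, Fintype.sum_prod_type]
  have h2 : hsSq M = ∑ p : ι × ι, ‖M p.1 p.2‖ ^ 2 := by simp only [hsSq, Fintype.sum_prod_type]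
  have h3 : hsSq N = ∑ p : ι × ι, ‖N p.2 p.1‖ ^ 2 := by
    simp only [hsSq, Fintype.sum_prod_type]
    rw [Finset.sum_comm]
  rw [h1, h2, h3]
  refine (norm_sum_le _ _).trans ?_
  simp only [norm_mul]
  exact Real.sum_mul_le_sqrt_mul_sqrt _ _ _

end HilbertSchmidt

/-! ### Complex powers of positive definite matrices -/

section ComplexPower

variable {ι : Type*} [Fintype ι] [DecidableEq ι]

/-- The complex power `A ^ z` of `A = spec U a`, for positive `a`. -/
def specCpow (U : Matrix ι ι ℂ) (a : ι → ℝ) (z : ℂ) : Matrix ι ι ℂ :=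
  U * Matrix.diagonal (fun i => Complex.exp (Real.log (a i) * z)) * Uᴴ

variable {U : Matrix ι ι ℂ} {a : ι → ℝ}

theorem specCpow_add (hU : U ∈ Matrix.unitaryGroup ι ℂ) (a : ι → ℝ) (z w : ℂ) :
    specCpow U a (z + w) = specCpow U a z * specCpow U a w := by
  have h : specCpow U a z * specCpow U a w =
      U * Matrix.diagonal (fun i => Complex.exp (Real.log (a i) * z)) * (Uᴴ * U) *
      Matrix.diagonal (fun i => Complex.exp (Real.log (a i) * w)) * Uᴴ := by
    simp only [specCpow, Matrix.mul_assoc]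
  rw [h, unitary_conjTranspose_mul hU, Matrix.mul_one, Matrix.mul_assoc U,
    Matrix.diagonal_mul_diagonal]
  simp only [specCpow, mul_add, Complex.exp_add]

theorem specCpow_ofReal (hU : U ∈ Matrix.unitaryGroup ι ℂ) (ha : ∀ i, 0 < a i) (x : ℝ) :
    specCpow U a x = psdPow (spec U a) x := by
  rw [psdPow_spec hU, specCpow, spec]
  congr 3
  ext i
  rw [Real.rpow_def_of_pos (ha i)]
  push_cast
  rfl

theorem specCpow_conjTranspose (U : Matrix ι ι ℂ) (a : ι → ℝ) (z : ℂ) :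
    (specCpow U a z)ᴴ = specCpow U a (starRingEnd ℂ z) := by
  simp only [specCpow, Matrix.conjTranspose_mul, Matrix.conjTranspose_conjTranspose,
    Matrix.diagonal_conjTranspose, Matrix.mul_assoc]
  congr 3
  ext i
  simp [← Complex.exp_conj]

theorem specCpow_zero (hU : U ∈ Matrix.unitaryGroup ι ℂ) (a : ι → ℝ) : specCpow U a 0 = 1 := by
  simp [specCpow, unitary_mul_conjTranspose hU]

theorem specCpow_I_mem (hU : U ∈ Matrix.unitaryGroup ι ℂ) (a : ι → ℝ) (t : ℝ) :
    specCpow U a (t * Complex.I) ∈ Matrix.unitaryGroup ι ℂ := by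
  rw [Matrix.mem_unitaryGroup_iff, Matrix.star_eq_conjTranspose, specCpow_conjTranspose,
    ← specCpow_add hU]
  simp [specCpow_zero hU]

theorem specCpow_entry_differentiable (U : Matrix ι ι ℂ) (a : ι → ℝ) (i j : ι) :
    Differentiable ℂ fun z => specCpow U a z i j := by
  have h : ∀ z, specCpow U a z i j =
      ∑ k, U i k * Complex.exp (Real.log (a k) * z) * Uᴴ k j := fun z => by
    rw [specCpow, Matrix.mul_apply]
    simp only [Matrix.mul_diagonal]
  simp only [h]
  fun_prop

theorem differentiable_mul_entry {M N : ℂ → Matrix ι ι ℂ}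
    (hM : ∀ i j, Differentiable ℂ fun z => M z i j) (hN : ∀ i j, Differentiable ℂ fun z => N z i j)
    (i j : ι) : Differentiable ℂ fun z => (M z * N z) i j := by
  simp only [Matrix.mul_apply]
  exact Differentiable.fun_sum fun k _ => (hM i k).mul (hN k j)

end ComplexPower

/-! ### Araki–Lieb–Thirring inequality by the three lines theorem -/

section ArakiLiebThirring

variable {ι : Type*} [Fintype ι] [DecidableEq ι]

open Complex.HadamardThreeLines in
/-- An instance of the Araki–Lieb–Thirring inequality. -/
theorem trace_psdPow_le_of_posDef {B C : Matrix ι ι ℂ} (hB : B.PosDef) (hC : C.PosDef) {α : ℝ}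
    (hα : 1 < α) :
    (psdPow (psdPow B (1 / α) * psdPow C (2 / α) * psdPow B (1 / α)) α).trace.re ≤
      (B * (C * C) * B).trace.re := by
  have hα0 : α ≠ 0 := by positivity
  set T := psdPow B (1 / α) * psdPow C (1 / α) with hT
  have hTH : Tᴴ = psdPow C (1 / α) * psdPow B (1 / α) := by
    rw [hT, Matrix.conjTranspose_mul, psdPow_conjTranspose, psdPow_conjTranspose]
  have hTT : psdPow B (1 / α) * psdPow C (2 / α) * psdPow B (1 / α) = T * Tᴴ := by
    rw [hTH, hT, show 2 / α = 1 / α + 1 / α by ring, ← psdPow_add hC]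
    simp only [Matrix.mul_assoc]
  rw [hTT]
  have hTu : IsUnit T := (psdPow_posDef hB _).isUnit.mul (psdPow_posDef hC _).isUnit
  have hY : (T * Tᴴ).PosDef := by
    have := (Matrix.IsUnit.posDef_star_right_conjugate_iff hTu).2 (Matrix.PosDef.one (n := ι) (R := ℂ))
    rwa [Matrix.mul_one] at this
  set Y := T * Tᴴ with hYdef
  -- The unitary factor in the polar decomposition `Tᴴ = O Y^{1/2}`.
  set O := Tᴴ * psdPow Y (-(1 / 2)) with hO
  have hOu : O ∈ Matrix.unitaryGroup ι ℂ := by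
    rw [Matrix.mem_unitaryGroup_iff', Matrix.star_eq_conjTranspose, hO, Matrix.conjTranspose_mul,
      psdPow_conjTranspose, Matrix.conjTranspose_conjTranspose, Matrix.mul_assoc,
      ← Matrix.mul_assoc T, ← hYdef]
    conv_lhs => enter [2, 1]; rw [← psdPow_one hY.1]
    rw [psdPow_add hY, psdPow_add hY, ← psdPow_zero hY.1]
    norm_num
  obtain ⟨U, hU, b, hb, hBs⟩ := exists_spec_posDef hB
  obtain ⟨V, hV, c, hc, hCs⟩ := exists_spec_posDef hC
  obtain ⟨W, hW, y, hy, hYs⟩ := exists_spec_posDef hY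
  set N : ℝ := (psdPow Y α).trace.re with hN
  have hYpow : ∀ p, hsSq (psdPow Y p) = (psdPow Y (p + p)).trace.re := by
    intro p
    have := hsSq_eq_trace (psdPow Y p)
    rw [psdPow_conjTranspose, psdPow_add hY] at this
    rw [← this]; simp
  have hN1 : hsSq (psdPow Y (α / 2)) = N := by rw [hYpow, add_halves]
  have hN0 : 0 ≤ N := hN1 ▸ hsSq_nonneg _
  set H : ℝ := hsSq (B * C) with hH
  have hHt : H = (B * (C * C) * B).trace.re := by
    have := hsSq_eq_trace (B * C)
    rw [Matrix.conjTranspose_mul, hB.1.eq, hC.1.eq] at this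
    rw [Matrix.mul_assoc B, Matrix.mul_assoc C, ← Matrix.mul_assoc B, ← this]; simp [hH]
  -- The interpolating function is chosen so that `F (1/α) = tr Y^α`, while at real parts `0` and
  -- `1` Cauchy–Schwarz gives the bounds `N` and `√H √N`; imaginary powers are unitary and drop out
  -- of the Hilbert–Schmidt norms.
  let F : ℂ → ℂ := fun z =>
    (specCpow U b z * specCpow V c z * O * specCpow W y (α - α / 2 * z)).trace
  have hsplit : ∀ (x t : ℝ), F (x + t * Complex.I) =
      ((specCpow U b (t * Complex.I) * (psdPow B x * psdPow C x)) *
        (specCpow V c (t * Complex.I) * O * specCpow W y ((-(α / 2 * t) : ℝ) * Complex.I)) *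
        psdPow Y (α - α / 2 * x)).trace := by
    intro x t
    have e1 : specCpow U b (x + t * Complex.I) = specCpow U b (t * Complex.I) * psdPow B x := by
      rw [add_comm, specCpow_add hU, specCpow_ofReal hU hb, ← hBs]
    have e2 : specCpow V c (x + t * Complex.I) = psdPow C x * specCpow V c (t * Complex.I) := by
      rw [specCpow_add hV, specCpow_ofReal hV hc, ← hCs]
    have e3 : specCpow W y (α - α / 2 * (x + t * Complex.I)) =
        specCpow W y ((-(α / 2 * t) : ℝ) * Complex.I) * psdPow Y (α - α / 2 * x) := by
      rw [hYs, ← specCpow_ofReal hW hy, ← specCpow_add hW]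
      congr 1; push_cast; ring
    simp only [F, e1, e2, e3, Matrix.mul_assoc]
  have hunit : ∀ t : ℝ, (specCpow V c (t * Complex.I) * O *
      specCpow W y ((-(α / 2 * t) : ℝ) * Complex.I)) ∈ Matrix.unitaryGroup ι ℂ := fun t =>
    mul_mem (mul_mem (specCpow_I_mem hV c t) hOu) (specCpow_I_mem hW y _)
  have hbound : ∀ x t : ℝ, ‖F (x + t * Complex.I)‖ ≤
      √(hsSq (psdPow B x * psdPow C x)) * √(hsSq (psdPow Y (α - α / 2 * x))) := by
    intro x t
    rw [hsplit]
    refine (norm_trace_mul_le _ _).trans ?_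
    rw [hsSq_mul_unitary _ (hunit t), hsSq_unitary_mul _ (specCpow_I_mem hU b t)]
  have hleft : ∀ t : ℝ, ‖F ((0 : ℝ) + t * Complex.I)‖ ≤ N := by
    intro t
    rw [hsplit, psdPow_zero hB.1, psdPow_zero hC.1, Matrix.one_mul, Matrix.mul_one]
    have : psdPow Y (α - α / 2 * 0) = psdPow Y (α / 2) * psdPow Y (α / 2) := by
      rw [psdPow_add hY]; congr 1; ring
    rw [this, ← Matrix.mul_assoc]
    refine (norm_trace_mul_le _ _).trans ?_
    rw [hsSq_unitary_mul _ (mul_mem (specCpow_I_mem hU b t) (hunit t)), hN1, Real.mul_self_sqrt hN0]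
  have hright : ∀ t : ℝ, ‖F ((1 : ℝ) + t * Complex.I)‖ ≤ √H * √N := by
    intro t
    refine (hbound 1 t).trans (le_of_eq ?_)
    rw [psdPow_one hB.1, psdPow_one hC.1, show α - α / 2 * 1 = α / 2 by ring, hN1]
  have hdiff : Differentiable ℂ F := by
    have h1 := specCpow_entry_differentiable U b
    have h2 := specCpow_entry_differentiable V c
    have h3 : ∀ i j, Differentiable ℂ fun z : ℂ => specCpow W y (α - α / 2 * z) i j := fun i j =>
      (specCpow_entry_differentiable W y i j).comp (by fun_prop : Differentiable ℂ fun z : ℂ =>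
        (α - α / 2 * z : ℂ))
    have h4 := differentiable_mul_entry (differentiable_mul_entry (differentiable_mul_entry h1 h2)
      (N := fun _ => O) fun i j => differentiable_const _) h3
    exact Differentiable.fun_sum fun i _ => h4 i i
  have hre : ∀ z : ℂ, z = (z.re : ℂ) + z.im * Complex.I := fun z => (Complex.re_add_im z).symm
  have hcont : Continuous fun x : ℝ =>
      √(hsSq (psdPow B x * psdPow C x)) * √(hsSq (psdPow Y (α - α / 2 * x))) := by
    have h1 : Continuous fun x : ℝ => hsSq (psdPow B x * psdPow C x) := by
      simp only [hsSq]
      refine continuous_finsetSum _ fun i _ => continuous_finsetSum _ fun j _ => ?_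
      have h := (differentiable_mul_entry (specCpow_entry_differentiable U b)
        (specCpow_entry_differentiable V c) i j).continuous.comp Complex.continuous_ofReal
      simp only [Function.comp_def, specCpow_ofReal hU hb, specCpow_ofReal hV hc, ← hBs, ← hCs] at h
      exact h.norm.pow 2
    have h2 : Continuous fun x : ℝ => hsSq (psdPow Y (α - α / 2 * x)) := by
      simp only [hsSq]
      refine continuous_finsetSum _ fun i _ => continuous_finsetSum _ fun j _ => ?_
      have h := (specCpow_entry_differentiable W y i j).continuous.comp
        (Complex.continuous_ofReal.comp (by fun_prop : Continuous fun x : ℝ => α - α / 2 * x))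
      simp only [Function.comp_def, specCpow_ofReal hW hy, ← hYs] at h
      exact h.norm.pow 2
    exact h1.sqrt.mul h2.sqrt
  -- The bound depends on the real part alone, continuously, and that ranges over a compact
  -- interval.
  have hbdd : BddAbove ((norm ∘ F) '' verticalClosedStrip 0 1) := by
    obtain ⟨K, hK⟩ := (isCompact_Icc (a := (0 : ℝ)) (b := 1)).bddAbove_image hcont.continuousOn
    refine ⟨K, ?_⟩
    rintro _ ⟨z, hz, rfl⟩
    have h1 := hbound z.re z.im
    rw [← hre z] at h1
    exact h1.trans (hK ⟨z.re, hz, rfl⟩)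
  have hα1 : 0 < 1 / α := by positivity
  have hα2 : 1 / α < 1 := by rw [div_lt_one (by positivity)]; exact hα
  have hthree := norm_le_interp_of_mem_verticalClosedStrip₀₁' F (z := ((1 / α : ℝ) : ℂ))
    (a := N) (b := √H * √N) ⟨by simpa using hα1.le, by simpa using hα2.le⟩ hdiff.diffContOnCl hbdd
    (fun z hz => by
      have := hleft z.im
      rwa [← (show z.re = 0 from hz), ← hre z] at this)
    (fun z hz => by
      have := hright z.im
      rwa [← (show z.re = 1 from hz), ← hre z] at this)
  -- Here `T O = Y Y^{-1/2} = Y^{1/2}`, and the last factor of `F` has exponent `α - 1/2`.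
  have hFθ : ‖F ((1 / α : ℝ) : ℂ)‖ = N := by
    have h1 := hsplit (1 / α) 0
    simp only [Complex.ofReal_zero, zero_mul, add_zero, mul_zero, neg_zero, specCpow_zero hU,
      specCpow_zero hV, specCpow_zero hW, Matrix.one_mul, Matrix.mul_one] at h1
    rw [h1, ← hT, hO, ← Matrix.mul_assoc T, ← hYdef]
    have e1 : Y * psdPow Y (-(1 / 2)) * psdPow Y (α - α / 2 * (1 / α)) = psdPow Y α := by
      conv_lhs => enter [1, 1]; rw [← psdPow_one hY.1]
      rw [psdPow_add hY, psdPow_add hY]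
      congr 1; field_simp; ring
    rw [e1]
    have h2 := hsSq_eq_trace (psdPow Y (α / 2))
    rw [psdPow_conjTranspose, psdPow_add hY, add_halves, hN1] at h2
    rw [← h2, Complex.norm_real, Real.norm_of_nonneg hN0]
  rw [hFθ, Complex.ofReal_re] at hthree
  rw [← hHt]
  -- The three lines bound is `N ≤ N^{1-1/α} (√H √N)^{1/α}`; cancelling the powers of `N > 0` leaves
  -- `√N ≤ √H`.
  rcases hN0.eq_or_lt with h0 | hpos
  · rw [← h0]; exact hsSq_nonneg _
  · have h1 : N = N ^ (1 - 1 / α) * N ^ (1 / α) := by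
      rw [← Real.rpow_add hpos]; simp
    have h2 : N ^ (1 / α) ≤ (√H * √N) ^ (1 / α) := by
      refine le_of_mul_le_mul_left ?_ (Real.rpow_pos_of_pos hpos (1 - 1 / α))
      rw [← h1]; exact hthree
    have h3 := (Real.rpow_le_rpow_iff hN0 (by positivity) hα1).1 h2
    have h4 : √N ≤ √H := by
      refine le_of_mul_le_mul_right ?_ (Real.sqrt_pos.2 hpos)
      rwa [Real.mul_self_sqrt hN0]
    exact (Real.sqrt_le_sqrt_iff (hsSq_nonneg _)).1 h4

end ArakiLiebThirring

/-! ### Young, monotonicity and Peierls inequalities for trace powers -/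

section TraceInequalities

variable {ι : Type*} [Fintype ι] [DecidableEq ι] {α : ℝ}

theorem sum_norm_sq_row {W : Matrix ι ι ℂ} (hW : W ∈ Matrix.unitaryGroup ι ℂ) (i : ι) :
    ∑ j, ‖W i j‖ ^ 2 = 1 := by
  have h := congrFun (congrFun (unitary_mul_conjTranspose hW) i) i
  simp only [Matrix.mul_apply, Matrix.conjTranspose_apply, Matrix.one_apply_eq] at h
  apply Complex.ofReal_injective
  push_cast
  rw [← h]
  refine Finset.sum_congr rfl fun j _ => ?_
  rw [← Complex.mul_conj']
  rfl

theorem sum_norm_sq_col {W : Matrix ι ι ℂ} (hW : W ∈ Matrix.unitaryGroup ι ℂ) (j : ι) :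
    ∑ i, ‖W i j‖ ^ 2 = 1 := by
  have hW' : Wᴴ ∈ Matrix.unitaryGroup ι ℂ := Unitary.star_mem hW
  simpa using sum_norm_sq_row hW' j

theorem trace_spec_mul_spec (U V : Matrix ι ι ℂ) (d e : ι → ℝ) :
    (spec U d * spec V e).trace = ((∑ i, ∑ j, d i * e j * ‖(Uᴴ * V) i j‖ ^ 2 : ℝ) : ℂ) := by
  have h : (spec U d * spec V e).trace = (Matrix.diagonal (fun i => (d i : ℂ)) * (Uᴴ * V) *
      Matrix.diagonal (fun i => (e i : ℂ)) * (Uᴴ * V)ᴴ).trace := by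
    have : spec U d * spec V e = U * (Matrix.diagonal (fun i => (d i : ℂ)) * (Uᴴ * V) *
      Matrix.diagonal (fun i => (e i : ℂ)) * Vᴴ) := by
      simp only [spec, Matrix.mul_assoc]
    rw [this, Matrix.trace_mul_comm, Matrix.conjTranspose_mul, Matrix.conjTranspose_conjTranspose]
    simp only [Matrix.mul_assoc]
  rw [h]
  simp only [Matrix.trace, Matrix.diag_apply]
  push_cast
  refine Finset.sum_congr rfl fun i _ => ?_
  rw [Matrix.mul_apply]
  refine Finset.sum_congr rfl fun j _ => ?_
  rw [Matrix.mul_diagonal, Matrix.diagonal_mul, Matrix.conjTranspose_apply, ← Complex.mul_conj']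
  simp only [RCLike.star_def]
  ring

/-- Young's inequality for the trace. -/
theorem trace_psdPow_mul_le {X Z : Matrix ι ι ℂ} (hX : X.PosSemidef) (hZ : Z.PosSemidef)
    (hα : 1 < α) :
    (psdPow X (α - 1) * Z).trace.re ≤
      (1 - 1 / α) * (psdPow X α).trace.re + 1 / α * (psdPow Z α).trace.re := by
  obtain ⟨U, hU, x, hx, rfl⟩ := exists_spec_posSemidef hX
  obtain ⟨V, hV, z, hz, rfl⟩ := exists_spec_posSemidef hZ
  have hα0 : 0 < α := by linarith
  have hα1 : 0 < α - 1 := by linarith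
  rw [psdPow_spec hU, psdPow_spec hU, psdPow_spec hV, trace_spec_mul_spec, spec_trace hU,
    spec_trace hV, Complex.ofReal_re, Complex.ofReal_re, Complex.ofReal_re]
  have hW : Uᴴ * V ∈ Matrix.unitaryGroup ι ℂ := mul_mem (Unitary.star_mem hU) hV
  -- Scalar Young for each pair of eigenvalues; the squared moduli of the entries of `Uᴴ * V` form a
  -- doubly stochastic matrix, so summing with these weights gives the traces.
  have hyoung : ∀ i j, x i ^ (α - 1) * z j ≤ (1 - 1 / α) * x i ^ α + 1 / α * z j ^ α := by
    intro i j
    have hc : (α / (α - 1)).HolderConjugate α := by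
      rw [Real.holderConjugate_iff]
      constructor
      · rw [lt_div_iff₀ hα1]; linarith
      · field_simp; ring
    have := Real.young_inequality_of_nonneg (Real.rpow_nonneg (hx i) (α - 1)) (hz j) hc
    rw [← Real.rpow_mul (hx i), mul_div_cancel₀ _ hα1.ne'] at this
    refine this.trans (le_of_eq ?_)
    field_simp
  calc ∑ i, ∑ j, x i ^ (α - 1) * z j * ‖(Uᴴ * V) i j‖ ^ 2
      ≤ ∑ i, ∑ j, ((1 - 1 / α) * x i ^ α + 1 / α * z j ^ α) * ‖(Uᴴ * V) i j‖ ^ 2 :=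
        Finset.sum_le_sum fun i _ => Finset.sum_le_sum fun j _ =>
          mul_le_mul_of_nonneg_right (hyoung i j) (sq_nonneg _)
    _ = ∑ i, ((1 - 1 / α) * x i ^ α) * ∑ j, ‖(Uᴴ * V) i j‖ ^ 2 +
        ∑ j, (1 / α * z j ^ α) * ∑ i, ‖(Uᴴ * V) i j‖ ^ 2 := by
        simp only [add_mul, Finset.sum_add_distrib, Finset.mul_sum]
        congr 1
        rw [Finset.sum_comm]
    _ = (1 - 1 / α) * ∑ i, x i ^ α + 1 / α * ∑ i, z i ^ α := by
        simp only [sum_norm_sq_row hW, sum_norm_sq_col hW, mul_one, Finset.mul_sum]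

theorem psdPow_sub_one_mul_self {X : Matrix ι ι ℂ} (hX : X.PosSemidef) (hα : 0 < α) :
    psdPow X (α - 1) * X = psdPow X α := by
  conv_lhs => enter [2]; rw [← psdPow_one hX.1]
  rw [psdPow_add_of_ne hX (by linarith), sub_add_cancel]

theorem trace_mul_le_trace_mul {P A B : Matrix ι ι ℂ} (hP : P.PosSemidef) (h : LoewnerLE A B) :
    (P * A).trace.re ≤ (P * B).trace.re := by
  have h1 := (h.conj (psdPow P (1 / 2))).trace_le
  have h2 : ∀ C, (psdPow P (1 / 2) * C * (psdPow P (1 / 2))ᴴ).trace = (P * C).trace := fun C => by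
    rw [psdPow_conjTranspose, Matrix.trace_mul_comm, ← Matrix.mul_assoc, psdPow_half_mul_half hP]
  rwa [h2, h2] at h1

/-- Young's inequality leaves `(1 - 1/α) tr X^α` on the right, which is absorbed on the left. Both
monotonicity and Peierls' inequality are instances. -/
theorem trace_psdPow_le_of_trace_mul_le {X Z : Matrix ι ι ℂ} (hX : X.PosSemidef) (hα : 1 < α)
    (hZ : Z.PosSemidef) (h : (psdPow X α).trace.re ≤ (psdPow X (α - 1) * Z).trace.re) :
    (psdPow X α).trace.re ≤ (psdPow Z α).trace.re := by
  have h1 := h.trans (trace_psdPow_mul_le hX hZ hα)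
  have h2 : 0 < 1 / α := by positivity
  refine le_of_mul_le_mul_left ?_ h2
  linarith

theorem trace_psdPow_mono {X Z : Matrix ι ι ℂ} (hX : X.PosSemidef) (hα : 1 < α)
    (h : LoewnerLE X Z) : (psdPow X α).trace.re ≤ (psdPow Z α).trace.re := by
  refine trace_psdPow_le_of_trace_mul_le hX hα (h.posSemidef hX) ?_
  rw [← psdPow_sub_one_mul_self hX (by linarith)]
  exact trace_mul_le_trace_mul (psdPow_posSemidef hX _) h

/-- Peierls' inequality for the powers with exponent at least one. -/
theorem sum_diag_rpow_le {Y U : Matrix ι ι ℂ} (hY : Y.PosSemidef)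
    (hU : U ∈ Matrix.unitaryGroup ι ℂ) (hα : 1 < α) :
    ∑ i, ((Uᴴ * Y * U) i i).re ^ α ≤ (psdPow Y α).trace.re := by
  have hpsd := hY.conjTranspose_mul_mul_same U
  set r : ι → ℝ := fun i => ((Uᴴ * Y * U) i i).re with hr
  have hr0 : ∀ i, 0 ≤ r i := fun i => (Complex.le_def.1 (hpsd.diag_nonneg (i := i))).1
  have hX := spec_posSemidef U hr0
  have e1 : (psdPow (spec U r) α).trace.re = ∑ i, r i ^ α := by
    rw [psdPow_spec hU, spec_trace hU, Complex.ofReal_re]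
  rw [← e1]
  -- Applied to the diagonal part of `Y` in the basis `U`; pairing it with `Y` sees only that
  -- diagonal, so the hypothesis is an equality.
  refine trace_psdPow_le_of_trace_mul_le hX hα hY (le_of_eq ?_)
  rw [e1, psdPow_spec hU, spec, Matrix.mul_assoc, Matrix.mul_assoc, Matrix.trace_mul_comm,
    Matrix.mul_assoc]
  simp only [Matrix.trace, Matrix.diag_apply, Matrix.diagonal_mul, Complex.re_sum,
    Complex.re_ofReal_mul]
  refine Finset.sum_congr rfl fun i _ => ?_
  rcases (hr0 i).eq_or_lt with h | h
  · change r i ^ α = r i ^ (α - 1) * r i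
    rw [← h, Real.zero_rpow (by linarith), mul_zero]
  · change r i ^ α = r i ^ (α - 1) * r i
    rw [Real.rpow_sub_one h.ne', div_mul_cancel₀ _ h.ne']

end TraceInequalities

/-! ### The sandwiched quantity is at most the sharp one -/

section SandwichedLeSharp

open Filter

variable {ι : Type*} [Fintype ι] [DecidableEq ι] {α : ℝ} {ρ σ A : Matrix ι ι ℂ}

theorem conj_psdPow_posSemidef (hρ : ρ.PosSemidef) (σ : Matrix ι ι ℂ) (p : ℝ) :
    (psdPow σ p * ρ * psdPow σ p).PosSemidef := by
  have := hρ.mul_mul_conjTranspose_same (psdPow σ p)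
  rwa [psdPow_conjTranspose] at this

theorem trace_sandwiched_le_of_posDef (hα : 1 < α) (hρ : ρ.PosSemidef) (hσ : σ.PosDef)
    (hA : A.PosDef) (h : LoewnerLE ρ (geomMeanPos (1 / α) σ A)) :
    (psdPow (psdPow σ ((1 - α) / (2 * α)) * ρ * psdPow σ ((1 - α) / (2 * α))) α).trace.re ≤
      A.trace.re := by
  have hα0 : α ≠ 0 := by positivity
  set s := (1 - α) / (2 * α) with hs
  set Z := psdPow σ (-(1 / 2)) * A * psdPow σ (-(1 / 2)) with hZ
  have hZpd : Z.PosDef := by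
    have := (Matrix.IsUnit.posDef_star_right_conjugate_iff (psdPow_posDef hσ (-(1 / 2))).isUnit).2 hA
    rwa [Matrix.star_eq_conjTranspose, psdPow_conjTranspose] at this
  have h1 := h.conj (psdPow σ s)
  rw [psdPow_conjTranspose] at h1
  refine (trace_psdPow_mono (conj_psdPow_posSemidef hρ σ s) hα h1).trans ?_
  have h2 := trace_psdPow_le_of_posDef (psdPow_posDef hσ (1 / 2)) (psdPow_posDef hZpd (1 / 2)) hα
  have e1 : psdPow σ s * geomMeanPos (1 / α) σ A * psdPow σ s =
      psdPow (psdPow σ (1 / 2)) (1 / α) * psdPow (psdPow Z (1 / 2)) (2 / α) *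
        psdPow (psdPow σ (1 / 2)) (1 / α) := by
    rw [psdPow_psdPow hσ.posSemidef, psdPow_psdPow hZpd.posSemidef, geomMeanPos, ← hZ]
    calc _ = (psdPow σ s * psdPow σ (1 / 2)) * psdPow Z (1 / α) *
          (psdPow σ (1 / 2) * psdPow σ s) := by simp only [Matrix.mul_assoc]
      _ = _ := by
        rw [psdPow_add hσ, psdPow_add hσ]
        have a1 : s + 1 / 2 = 1 / 2 * (1 / α) := by rw [hs]; field_simp; ring
        have a2 : 1 / α = 1 / 2 * (2 / α) := by field_simp
        rw [add_comm (1 / 2 : ℝ) s, a1, ← a2]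
  have e2 : psdPow σ (1 / 2) * (psdPow Z (1 / 2) * psdPow Z (1 / 2)) * psdPow σ (1 / 2) = A := by
    rw [psdPow_half_mul_half hZpd.posSemidef, hZ]
    calc _ = (psdPow σ (1 / 2) * psdPow σ (-(1 / 2))) * A *
          (psdPow σ (-(1 / 2)) * psdPow σ (1 / 2)) := by simp only [Matrix.mul_assoc]
      _ = A := by rw [psdPow_mul_neg hσ, psdPow_neg_mul hσ, Matrix.one_mul, Matrix.mul_one]
  rw [e1]
  rwa [e2] at h2

/-- For negative `p` the regularized power blows up on the kernel of `σ`; the support projection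
removes exactly that part. -/
theorem tendsto_psdPow_mul_suppProj (hσ : σ.PosSemidef) {p : ℝ} (hp : p ≠ 0) :
    Tendsto (fun ε : ℝ => psdPow (σ + (ε : ℂ) • 1) p * (σ * psdPow σ (-1))) (𝓝[>] 0)
      (𝓝 (psdPow σ p)) := by
  obtain ⟨U, hU, d, hd, rfl⟩ := exists_spec_posSemidef hσ
  simp only [spec_add_smul_one hU, psdPow_spec hU, spec_mul hU]
  refine tendsto_spec U fun i => ?_
  rcases (hd i).eq_or_lt with h | h
  · simp [← h, Real.zero_rpow hp]
  · rw [Real.rpow_neg_one, mul_inv_cancel₀ h.ne']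
    simp only [mul_one]
    exact (tendsto_add_nhdsGT_zero (d i)).rpow_const (Or.inl h.ne')

theorem suppLE_of_loewnerLE_geomMean {β : ℝ} (hβ0 : 0 < β) (hβ1 : β < 1) (hρ : ρ.PosSemidef)
    (hσ : σ.PosSemidef) (hA : A.PosSemidef) (h : LoewnerLE ρ (geomMean β σ A)) : SuppLE ρ σ := by
  obtain ⟨c, -, hc⟩ := geomMean_le_smul_psdPow hβ0 hβ1 hσ hA
  exact suppLE_of_loewnerLE_psdPow hρ hσ (p := 1 - β) (by linarith) (h.trans hc)

theorem trace_sandwiched_le (hα : 1 < α) (hρ : ρ.PosSemidef) (hσ : σ.PosSemidef)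
    (hA : A.PosSemidef) (h : LoewnerLE ρ (geomMean (1 / α) σ A)) :
    (psdPow (psdPow σ ((1 - α) / (2 * α)) * ρ * psdPow σ ((1 - α) / (2 * α))) α).trace.re ≤
      A.trace.re := by
  have hα0 : 0 < α := by linarith
  have hβ0 : 0 < 1 / α := by positivity
  have hβ1 : 1 / α < 1 := by rw [div_lt_one hα0]; exact hα
  have hsupp := (suppLE_iff hσ).1 (suppLE_of_loewnerLE_geomMean hβ0 hβ1 hρ hσ hA h)
  set s := (1 - α) / (2 * α) with hs
  have hs0 : s ≠ 0 := div_ne_zero (by linarith) (by positivity)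
  set X := psdPow σ s * ρ * psdPow σ s with hX
  have hXp : X.PosSemidef := conj_psdPow_posSemidef hρ σ s
  let Xε : ℝ → Matrix ι ι ℂ := fun ε =>
    psdPow (σ + (ε : ℂ) • 1) s * ρ * psdPow (σ + (ε : ℂ) • 1) s
  set P := σ * psdPow σ (-1) with hP
  have hlim : Tendsto Xε (𝓝[>] 0) (𝓝 X) := by
    have h1 := tendsto_psdPow_mul_suppProj hσ hs0
    rw [← hP] at h1
    have h2 : Tendsto (fun ε : ℝ => (psdPow (σ + (ε : ℂ) • 1) s * P)ᴴ) (𝓝[>] 0)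
        (𝓝 (psdPow σ s)ᴴ) :=
      (Continuous.matrix_conjTranspose continuous_id).continuousAt.tendsto.comp h1
    rw [psdPow_conjTranspose] at h2
    refine ((h1.mul (tendsto_const_nhds (x := ρ))).mul h2).congr fun ε => ?_
    have hρP : ρ * Pᴴ = ρ := by
      have := congrArg Matrix.conjTranspose hsupp
      rwa [Matrix.conjTranspose_mul, hρ.1.eq] at this
    rw [Matrix.conjTranspose_mul, psdPow_conjTranspose]
    calc _ = psdPow (σ + (ε : ℂ) • 1) s * (P * ρ * Pᴴ) * psdPow (σ + (ε : ℂ) • 1) s := by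
          simp only [Matrix.mul_assoc]
      _ = _ := by rw [hsupp, hρP]
  have hb : ∀ ε : ℝ, 0 < ε → (psdPow (Xε ε) α).trace.re ≤ (A + (ε : ℂ) • 1).trace.re := fun ε hε =>
    trace_sandwiched_le_of_posDef hα hρ (posDef_add_smul_one hσ hε) (posDef_add_smul_one hA hε)
      (h.trans (geomMean_le_geomMeanPos hβ0 hβ1 hσ hA hε))
  have htr : Continuous fun M : Matrix ι ι ℂ => M.trace.re :=
    Complex.continuous_re.comp (Continuous.matrix_trace continuous_id)
  -- Continuity of the power `α` is avoided: the pairing with the fixed `X^{α-1}` is linear in `Xε`,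
  -- Young bounds it using `tr Xε^α ≤ tr (A + ε)`, and only linear expressions pass to the limit.
  have h1 : Tendsto (fun ε => (psdPow X (α - 1) * Xε ε).trace.re) (𝓝[>] 0)
      (𝓝 (psdPow X (α - 1) * X).trace.re) :=
    (htr.tendsto _).comp (tendsto_const_nhds.mul hlim)
  have h2 : Tendsto (fun ε : ℝ => (1 - 1 / α) * (psdPow X α).trace.re +
      1 / α * (A + (ε : ℂ) • 1).trace.re) (𝓝[>] 0)
      (𝓝 ((1 - 1 / α) * (psdPow X α).trace.re + 1 / α * A.trace.re)) :=
    (((htr.tendsto _).comp (tendsto_add_smul_one A)).const_mul _).const_add _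
  have h3 := le_of_tendsto_of_tendsto h1 h2 (by
    filter_upwards [self_mem_nhdsWithin] with ε hε
    refine (trace_psdPow_mul_le hXp (conj_psdPow_posSemidef hρ _ s) hα).trans ?_
    have := mul_le_mul_of_nonneg_left (hb ε hε) hβ0.le
    linarith)
  rw [psdPow_sub_one_mul_self hXp hα0] at h3
  refine le_of_mul_le_mul_left ?_ hβ0
  linarith

theorem sandwichedQ_le_sharpQ (hα : 1 < α) (hρ : ρ.PosSemidef) (hσ : σ.PosSemidef) :
    sandwichedQ α ρ σ ≤ sharpQ α ρ σ := by
  refine le_iInf fun A => le_iInf fun hA => le_iInf fun h => ?_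
  have hβ0 : 0 < 1 / α := by positivity
  have hβ1 : 1 / α < 1 := by rw [div_lt_one (by linarith)]; exact hα
  rw [sandwichedQ, if_pos (suppLE_of_loewnerLE_geomMean hβ0 hβ1 hρ hσ hA h)]
  exact ENNReal.ofReal_le_ofReal (trace_sandwiched_le hα hρ hσ hA h)

end SandwichedLeSharp

/-! ### Pinching in an eigenbasis of the second operator -/

section Pinching

variable {ι : Type*} [Fintype ι] [DecidableEq ι] {α : ℝ} {ρ σ : Matrix ι ι ℂ}

/-- Any Hermitian `R` is diagonalized on each level set of `e` by a unitary which preserves these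
level sets. -/
theorem exists_unitary_diag_on_levels (e : ι → ℝ) {R : Matrix ι ι ℂ} (hR : R.IsHermitian) :
    ∃ W ∈ Matrix.unitaryGroup ι ℂ, (∀ i j, e i ≠ e j → W i j = 0) ∧
      ∀ i j, i ≠ j → e i = e j → (Wᴴ * R * W) i j = 0 := by
  let S : ∀ y : ℝ, Matrix ι {x // e x = y} ℂ := fun y => Matrix.of fun i a => if i = a then 1 else 0
  have hSS : ∀ y, (S y)ᴴ * S y = 1 := by
    intro y
    ext a b
    simp [S, Matrix.mul_apply, Matrix.one_apply, Subtype.ext_iff, eq_comm]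
  have hblock : ∀ y, ∃ V : Matrix {x // e x = y} {x // e x = y} ℂ, ∃ d : {x // e x = y} → ℂ,
      Vᴴ * V = 1 ∧ Vᴴ * ((S y)ᴴ * R * S y) * V = Matrix.diagonal d := by
    intro y
    obtain ⟨V, hV, h, -⟩ := exists_spec (Matrix.isHermitian_conjTranspose_mul_mul (S y) hR)
    refine ⟨V, fun i => (((Matrix.isHermitian_conjTranspose_mul_mul (S y) hR).eigenvalues i : ℝ) : ℂ),
      unitary_conjTranspose_mul hV, ?_⟩
    conv_lhs => rw [h]
    rw [spec, Matrix.mul_assoc, Matrix.mul_assoc, unitary_conjTranspose_mul hV, Matrix.mul_one,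
      ← Matrix.mul_assoc, unitary_conjTranspose_mul hV, Matrix.one_mul]
  choose V d hV hd using hblock
  -- Block by block: `S y` includes the level set of `y`, `V y` diagonalizes the compression of `R`
  -- to it, and column `j` of `W` is taken from the block of level `e j`.
  let W : Matrix ι ι ℂ := Matrix.of fun i j => (S (e j) * V (e j)) i ⟨j, rfl⟩
  have hW : ∀ (i j : ι) (y : ℝ) (h : e j = y), W i j = (S y * V y) i ⟨j, h⟩ := by
    rintro i j y rfl; rfl
  have hWM : ∀ (M : Matrix ι ι ℂ) (i j : ι) (y : ℝ) (hi : e i = y) (hj : e j = y),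
      (Wᴴ * M * W) i j = ((V y)ᴴ * ((S y)ᴴ * M * S y) * V y) ⟨i, hi⟩ ⟨j, hj⟩ := by
    intro M i j y hi hj
    have : (V y)ᴴ * ((S y)ᴴ * M * S y) * V y = (S y * V y)ᴴ * M * (S y * V y) := by
      rw [Matrix.conjTranspose_mul]; simp only [Matrix.mul_assoc]
    rw [this, Matrix.mul_apply, Matrix.mul_apply]
    refine Finset.sum_congr rfl fun k _ => ?_
    rw [hW _ j y hj, Matrix.mul_apply, Matrix.mul_apply]
    congr 1
    refine Finset.sum_congr rfl fun l _ => ?_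
    change star (W l i) * M l k = star ((S y * V y) l ⟨i, hi⟩) * M l k
    rw [hW _ i y hi]
  have hW0 : ∀ i j, e i ≠ e j → W i j = 0 := by
    intro i j hij
    change (S (e j) * V (e j)) i ⟨j, rfl⟩ = 0
    rw [Matrix.mul_apply]
    refine Finset.sum_eq_zero fun a _ => ?_
    have : i ≠ a := fun h => hij (h ▸ a.2)
    simp [S, this]
  have hWW : Wᴴ * W = 1 := by
    ext i j
    by_cases hij : e i = e j
    · have := hWM 1 i j (e j) hij rfl
      rw [Matrix.mul_one, Matrix.mul_one, hSS, Matrix.mul_one, hV] at this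
      rw [this]
      simp [Matrix.one_apply, Subtype.ext_iff]
    · rw [Matrix.one_apply_ne (fun h => hij (congrArg e h)), Matrix.mul_apply]
      refine Finset.sum_eq_zero fun k _ => ?_
      by_cases hk : e k = e i
      · rw [hW0 k j (hk ▸ hij), mul_zero]
      · rw [Matrix.conjTranspose_apply, hW0 k i hk, star_zero, zero_mul]
  refine ⟨W, Matrix.mem_unitaryGroup_iff'.2 hWW, hW0, fun i j hij he => ?_⟩
  rw [hWM R i j (e j) he rfl, hd, Matrix.diagonal_apply_ne]
  simpa [Subtype.ext_iff] using hij

/-- An eigenbasis of `σ` in which the compression of `ρ` to each eigenspace of `σ` is diagonal. -/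
theorem exists_adapted_spec (hρ : ρ.IsHermitian) (hσ : σ.PosSemidef) :
    ∃ U ∈ Matrix.unitaryGroup ι ℂ, ∃ d : ι → ℝ, (∀ i, 0 ≤ d i) ∧ σ = spec U d ∧
      ∀ i j, i ≠ j → d i = d j → (Uᴴ * ρ * U) i j = 0 := by
  obtain ⟨V, hV, e, he, rfl⟩ := exists_spec_posSemidef hσ
  obtain ⟨W, hW, hW0, hWR⟩ :=
    exists_unitary_diag_on_levels e (Matrix.isHermitian_conjTranspose_mul_mul V hρ)
  have hcomm : W * Matrix.diagonal (fun i => (e i : ℂ)) = Matrix.diagonal (fun i => (e i : ℂ)) * W := by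
    ext i j
    rw [Matrix.mul_diagonal, Matrix.diagonal_mul]
    by_cases h : e i = e j
    · rw [h, mul_comm]
    · rw [hW0 i j h, zero_mul, mul_zero]
  refine ⟨V * W, mul_mem hV hW, e, he, ?_, fun i j hij h => ?_⟩
  · rw [spec, spec, Matrix.conjTranspose_mul, Matrix.mul_assoc V W, hcomm]
    calc _ = V * Matrix.diagonal (fun i => (e i : ℂ)) * (W * Wᴴ) * Vᴴ := by
          rw [unitary_mul_conjTranspose hW, Matrix.mul_one]
      _ = _ := by simp only [Matrix.mul_assoc]
  · have := hWR i j hij h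
    rw [Matrix.conjTranspose_mul]
    simpa only [Matrix.mul_assoc] using this

/-- The pinching inequality. -/
theorem loewnerLE_pinching {R : Matrix ι ι ℂ} (hR : R.PosSemidef) {d : ι → ℝ}
    (h0 : ∀ i j, i ≠ j → d i = d j → R i j = 0) :
    LoewnerLE R ((((Finset.univ.image d).card : ℝ) : ℂ) •
      Matrix.diagonal fun i => (((R i i).re : ℝ) : ℂ)) := by
  set S := Finset.univ.image d with hS
  let E : ℝ → Matrix ι ι ℂ := fun t => Matrix.diagonal fun i => if d i = t then 1 else 0
  have hEH : ∀ t, (E t)ᴴ = E t := by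
    intro t
    simp only [E, Matrix.diagonal_conjTranspose]
    congr 1
    ext i
    by_cases h : d i = t <;> simp [h]
  have hsum : ∑ t ∈ S, E t = 1 := by
    ext i j
    rw [Matrix.sum_apply]
    by_cases hij : i = j
    · subst hij
      simp [E, hS]
    · simp [E, Matrix.diagonal_apply_ne _ hij, Matrix.one_apply_ne hij]
  have hpinch : ∑ t ∈ S, E t * R * E t = Matrix.diagonal fun i => (((R i i).re : ℝ) : ℂ) := by
    ext i j
    rw [Matrix.sum_apply]
    simp only [E, Matrix.mul_diagonal, Matrix.diagonal_mul]
    by_cases hij : i = j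
    · subst hij
      rw [Matrix.diagonal_apply_eq, Finset.sum_eq_single (d i)]
      · have : (R i i).im = 0 := by
          have := congrArg Complex.im (congrFun (congrFun hR.1 i) i)
          simp at this
          linarith
        apply Complex.ext <;> simp [this]
      · intro t _ ht
        simp [ht.symm]
      · intro h
        exact absurd (Finset.mem_image_of_mem d (Finset.mem_univ i)) h
    · rw [Matrix.diagonal_apply_ne _ hij]
      refine Finset.sum_eq_zero fun t _ => ?_
      by_cases h1 : d i = t
      · by_cases h2 : d j = t
        · simp [h0 i j hij (h1.trans h2.symm)]
        · simp [h2]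
      · simp [h1]
  -- Because the `E t` sum to the identity, the cross terms add up to `2 R`. Twice the gap in the
  -- pinching inequality is thus visibly positive semidefinite.
  have hid : ∑ s ∈ S, ∑ t ∈ S, (E s - E t) * R * (E s - E t)ᴴ =
      (2 : ℂ) • (((S.card : ℝ) : ℂ) • (∑ t ∈ S, E t * R * E t) - R) := by
    have e1 : ∀ s t, (E s - E t) * R * (E s - E t)ᴴ =
        E s * R * E s - E s * R * E t - (E t * R * E s - E t * R * E t) := by
      intro s t
      rw [Matrix.conjTranspose_sub, hEH, hEH]
      noncomm_ring
    have e2 : ∑ s ∈ S, ∑ t ∈ S, E s * R * E t = R := by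
      simp only [← Finset.mul_sum, ← Finset.sum_mul, hsum, Matrix.one_mul, Matrix.mul_one]
    have e3 : ∑ s ∈ S, ∑ t ∈ S, E t * R * E s = R := by rw [Finset.sum_comm, e2]
    simp only [e1, Finset.sum_sub_distrib, e2, e3, Finset.sum_const]
    rw [← Finset.smul_sum, ← Nat.cast_smul_eq_nsmul ℂ, two_smul]
    push_cast
    abel
  rw [LoewnerLE, ← hpinch]
  have hpsd : (∑ s ∈ S, ∑ t ∈ S, (E s - E t) * R * (E s - E t)ᴴ).PosSemidef :=
    Matrix.posSemidef_sum _ fun s _ => Matrix.posSemidef_sum _ fun t _ =>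
      hR.mul_mul_conjTranspose_same _
  rw [hid] at hpsd
  have := hpsd.smul (a := (1 / 2 : ℂ)) (by
    rw [show (1 / 2 : ℂ) = ((1 / 2 : ℝ) : ℂ) by push_cast; rfl]
    exact_mod_cast (by norm_num : (0 : ℝ) ≤ 1 / 2))
  rw [smul_smul] at this
  norm_num at this
  exact this

theorem sharpQ_le_mul_sandwichedQ (hα : 1 < α) (hρ : ρ.PosSemidef) (hσ : σ.PosSemidef) {v : ℕ}
    (hv0 : 0 < v) (hv : ∀ U ∈ Matrix.unitaryGroup ι ℂ, ∀ d : ι → ℝ, σ = spec U d →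
      (Finset.univ.image d).card ≤ v) :
    sharpQ α ρ σ ≤ ENNReal.ofReal ((v : ℝ) ^ α) * sandwichedQ α ρ σ := by
  have hα0 : 0 < α := by linarith
  have hβ0 : 0 < 1 / α := by positivity
  have hβ1 : 1 / α < 1 := by rw [div_lt_one hα0]; exact hα
  have hvpos : (0 : ℝ) < (v : ℝ) ^ α := Real.rpow_pos_of_pos (by exact_mod_cast hv0) _
  by_cases hs : SuppLE ρ σ
  swap
  · rw [sandwichedQ, if_neg hs, ENNReal.mul_top (by simpa using hvpos)]
    exact le_top
  rw [sandwichedQ, if_pos hs, ← ENNReal.ofReal_mul hvpos.le]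
  have hs' := (suppLE_iff hσ).1 hs
  obtain ⟨U, hU, d, hd, hσd, hdiag⟩ := exists_adapted_spec hρ.1 hσ
  have hvd := hv U hU d hσd
  subst hσd
  set R := Uᴴ * ρ * U with hR
  have hRp : R.PosSemidef := hρ.conjTranspose_mul_mul_same U
  set r : ι → ℝ := fun i => (R i i).re with hr
  have hr0 : ∀ i, 0 ≤ r i := fun i => (Complex.le_def.1 (hRp.diag_nonneg (i := i))).1
  -- The support condition annihilates the diagonal of `R` on the kernel of `σ`, where no choice of
  -- `A` could compensate.
  have hrd : ∀ i, d i = 0 → r i = 0 := by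
    intro i hi
    have e1 : R = Matrix.diagonal (fun i => ((d i * d i ^ (-1 : ℝ) : ℝ) : ℂ)) * R := by
      conv_lhs => rw [hR, ← hs', psdPow_spec hU, spec_mul hU, spec]
      rw [hR]
      simp only [Matrix.mul_assoc]
      rw [← Matrix.mul_assoc Uᴴ U, unitary_conjTranspose_mul hU, Matrix.one_mul]
    have e2 := congrFun (congrFun e1 i) i
    rw [Matrix.diagonal_mul, hi] at e2
    rw [zero_mul, Complex.ofReal_zero, zero_mul] at e2
    simp only [hr]
    rw [e2, Complex.zero_re]
  have hUR : ρ = U * R * Uᴴ := by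
    rw [hR]
    calc ρ = (U * Uᴴ) * ρ * (U * Uᴴ) := by rw [unitary_mul_conjTranspose hU]; simp
      _ = _ := by simp only [Matrix.mul_assoc]
  -- The solution of `d^{1-1/α} a^{1/α} = v r`. Where `d i = 0` the convention `0 ^ (1 - α) = 0`
  -- gives `a i = 0`, consistent with `r i = 0`.
  set a : ι → ℝ := fun i => (v : ℝ) ^ α * (r i ^ α * d i ^ (1 - α)) with ha
  have ha0 : ∀ i, 0 ≤ a i := fun i =>
    mul_nonneg hvpos.le (mul_nonneg (Real.rpow_nonneg (hr0 i) _) (Real.rpow_nonneg (hd i) _))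
  have hmean : geomMean (1 / α) (spec U d) (spec U a) = spec U fun i => (v : ℝ) * r i := by
    rw [geomMean_spec hβ0 hβ1 hU hd ha0]
    congr 1
    ext i
    rcases (hd i).eq_or_lt with h | h
    · rw [hrd i h.symm, ← h, Real.zero_rpow (by linarith), zero_mul, mul_zero]
    · simp only [ha]
      rw [Real.mul_rpow hvpos.le (mul_nonneg (Real.rpow_nonneg (hr0 i) _) (Real.rpow_nonneg h.le _)),
        Real.mul_rpow (Real.rpow_nonneg (hr0 i) _) (Real.rpow_nonneg h.le _),
        ← Real.rpow_mul (Nat.cast_nonneg v), ← Real.rpow_mul (hr0 i), ← Real.rpow_mul h.le,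
        mul_one_div_cancel hα0.ne', Real.rpow_one, Real.rpow_one]
      have : d i ^ (1 - 1 / α) * d i ^ ((1 - α) * (1 / α)) = 1 := by
        rw [← Real.rpow_add h]
        have : 1 - 1 / α + (1 - α) * (1 / α) = 0 := by field_simp; ring
        rw [this, Real.rpow_zero]
      linear_combination (v : ℝ) * r i * this
  have hle : LoewnerLE ρ (geomMean (1 / α) (spec U d) (spec U a)) := by
    rw [hmean]
    have h1 := (loewnerLE_pinching hRp hdiag).conj U
    rw [← hUR] at h1
    refine h1.trans ?_
    rw [Matrix.mul_smul, Matrix.smul_mul]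
    change LoewnerLE ((((Finset.univ.image d).card : ℝ) : ℂ) • spec U r) _
    rw [← spec_smul U (v : ℝ) r, LoewnerLE, ← sub_smul, ← Complex.ofReal_sub, spec_smul]
    refine spec_posSemidef U fun i => mul_nonneg (sub_nonneg.2 ?_) (hr0 i)
    exact_mod_cast hvd
  refine (iInf₂_le_of_le (spec U a) (spec_posSemidef U ha0) (iInf_le _ hle)).trans
    (ENNReal.ofReal_le_ofReal ?_)
  rw [spec_trace hU, Complex.ofReal_re, ha, ← Finset.mul_sum]
  refine mul_le_mul_of_nonneg_left ?_ hvpos.le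
  refine le_trans (le_of_eq ?_)
    (sum_diag_rpow_le (conj_psdPow_posSemidef hρ _ ((1 - α) / (2 * α))) hU hα)
  refine Finset.sum_congr rfl fun i _ => ?_
  set s := (1 - α) / (2 * α) with hs
  have hs0 : s ≠ 0 := div_ne_zero (by linarith) (by positivity)
  have e1 : Uᴴ * (psdPow (spec U d) s * ρ * psdPow (spec U d) s) * U =
      Matrix.diagonal (fun i => ((d i ^ s : ℝ) : ℂ)) * R *
        Matrix.diagonal (fun i => ((d i ^ s : ℝ) : ℂ)) := by
    rw [psdPow_spec hU, spec, hR]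
    calc _ = (Uᴴ * U) * Matrix.diagonal (fun i => ((d i ^ s : ℝ) : ℂ)) * (Uᴴ * ρ * U) *
        Matrix.diagonal (fun i => ((d i ^ s : ℝ) : ℂ)) * (Uᴴ * U) := by simp only [Matrix.mul_assoc]
      _ = _ := by rw [unitary_conjTranspose_mul hU, Matrix.one_mul, Matrix.mul_one]
  have e2 : ((Uᴴ * (psdPow (spec U d) s * ρ * psdPow (spec U d) s) * U) i i).re =
      d i ^ s * r i * d i ^ s := by
    rw [e1, Matrix.mul_diagonal, Matrix.diagonal_mul, Complex.re_mul_ofReal, Complex.re_ofReal_mul]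
  rw [e2, mul_right_comm, mul_comm (_ * _) (r i), Real.mul_rpow (hr0 i)
    (mul_nonneg (Real.rpow_nonneg (hd i) _) (Real.rpow_nonneg (hd i) _)), ← Real.rpow_add' (hd i) (by
      rw [← two_mul]; exact mul_ne_zero two_ne_zero hs0), ← Real.rpow_mul (hd i)]
  congr 2
  rw [hs]; field_simp; ring

end Pinching

/-! ### Sharp quantity under families of conjugations -/

section ConjFamily

variable {ι : Type*} [Fintype ι] [DecidableEq ι] {α : ℝ} {ρ σ ρ' σ' : Matrix ι ι ℂ}

/-- `sharpQ` does not decrease from `(ρ, σ)` to `(ρ', σ')` if `(ρ, σ)` is the image of `(ρ', σ')`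
under each operation `A ↦ L i * A * (L i)ᴴ` of a family which is trace nonincreasing on average. -/
theorem sharpQ_le_of_conj_family {m : Type*} [Fintype m] [Nonempty m] (hα : 1 < α)
    (hσ' : σ'.PosSemidef) (L : m → Matrix ι ι ℂ)
    (hLρ : ∀ i, L i * ρ' * (L i)ᴴ = ρ) (hLσ : ∀ i, L i * σ' * (L i)ᴴ = σ)
    (hL : LoewnerLE (∑ i, (L i)ᴴ * L i) (((Fintype.card m : ℝ) : ℂ) • 1)) :
    sharpQ α ρ σ ≤ sharpQ α ρ' σ' := by
  have hβ0 : 0 < 1 / α := by positivity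
  have hβ1 : 1 / α < 1 := by rw [div_lt_one (by linarith)]; exact hα
  refine le_iInf fun A => le_iInf fun hA => le_iInf fun h => ?_
  have hfeas : ∀ i, LoewnerLE ρ (geomMean (1 / α) σ (L i * A * (L i)ᴴ)) := by
    intro i
    have h1 := (h.conj (L i)).trans (conj_geomMean_le hβ0 hβ1 hσ' hA (L i))
    rwa [hLρ, hLσ] at h1
  have hsum : ∑ i, (L i * A * (L i)ᴴ).trace.re ≤ ∑ _i : m, A.trace.re := by
    have h1 := trace_mul_le_trace_mul hA hL
    have h2 : ∀ i, (L i * A * (L i)ᴴ).trace.re = (A * ((L i)ᴴ * L i)).trace.re := by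
      intro i
      rw [Matrix.mul_assoc, Matrix.trace_mul_comm, Matrix.mul_assoc]
    rw [Finset.mul_sum, Matrix.trace_sum, Complex.re_sum, Matrix.mul_smul, Matrix.mul_one,
      Matrix.trace_smul, smul_eq_mul, Complex.re_ofReal_mul] at h1
    simpa [h2] using h1
  -- Every `L i * A * (L i)ᴴ` is feasible for `(ρ, σ)` and their traces average to at most `tr A`,
  -- so one of them is as good as `A`.
  obtain ⟨i, -, hi⟩ := Finset.exists_le_of_sum_le Finset.univ_nonempty hsum
  exact (iInf₂_le_of_le _ (hA.mul_mul_conjTranspose_same (L i)) (iInf_le _ (hfeas i))).trans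
    (ENNReal.ofReal_le_ofReal hi)

end ConjFamily

/-! ### Permutation matrices and conjugation by square roots of input states -/

section Permutations

variable {ι κ : Type*} [Fintype ι] [DecidableEq ι] [Fintype κ] [DecidableEq κ]

/-- The permutation matrix of `e`. -/
def permMat (e : Equiv.Perm ι) : Matrix ι ι ℂ := (1 : Matrix ι ι ℂ).submatrix e id

theorem permMat_mul_mul (e : Equiv.Perm ι) (M : Matrix ι ι ℂ) :
    permMat e * M * (permMat e)ᴴ = M.submatrix e e := by
  ext i j
  simp [permMat, Matrix.mul_apply, Matrix.one_apply]

theorem permMat_mem (e : Equiv.Perm ι) : permMat e ∈ Matrix.unitaryGroup ι ℂ := by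
  rw [Matrix.mem_unitaryGroup_iff, Matrix.star_eq_conjTranspose]
  have := permMat_mul_mul e 1
  rwa [Matrix.mul_one, Matrix.submatrix_one_equiv] at this

theorem psdPow_submatrix {A : Matrix ι ι ℂ} (hA : A.IsHermitian) (e : Equiv.Perm ι) (p : ℝ) :
    psdPow (A.submatrix e e) p = (psdPow A p).submatrix e e := by
  rw [← permMat_mul_mul, psdPow_unitary_conj hA (permMat_mem e), permMat_mul_mul]

theorem conjSqrt_submatrix {ω : Matrix ι ι ℂ} (hω : ω.IsHermitian)
    (J : Matrix (ι × κ) (ι × κ) ℂ) (e : Equiv.Perm ι) (f : Equiv.Perm κ) :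
    conjSqrt (ω.submatrix e e) (J.submatrix (e.prodCongr f) (e.prodCongr f)) =
      (conjSqrt ω J).submatrix (e.prodCongr f) (e.prodCongr f) := by
  have h : psdPow (ω.submatrix e e) (1 / 2) ⊗ₖ (1 : Matrix κ κ ℂ) =
      (psdPow ω (1 / 2) ⊗ₖ (1 : Matrix κ κ ℂ)).submatrix (e.prodCongr f) (e.prodCongr f) := by
    rw [psdPow_submatrix hω]
    conv_lhs => rw [← Matrix.submatrix_one_equiv f]
    ext i j
    rfl
  rw [conjSqrt, h, conjSqrt, Matrix.submatrix_mul_equiv, Matrix.submatrix_mul_equiv]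

theorem conjSqrt_posSemidef {J : Matrix (ι × κ) (ι × κ) ℂ} (hJ : J.PosSemidef)
    (ω : Matrix ι ι ℂ) : (conjSqrt ω J).PosSemidef := by
  have := hJ.mul_mul_conjTranspose_same (psdPow ω (1 / 2) ⊗ₖ (1 : Matrix κ κ ℂ))
  rwa [Matrix.conjTranspose_kronecker, psdPow_conjTranspose, Matrix.conjTranspose_one] at this

theorem kronecker_mul_conjSqrt {ω τ K : Matrix ι ι ℂ} (J : Matrix (ι × κ) (ι × κ) ℂ)
    (hK : K * psdPow ω (1 / 2) = psdPow τ (1 / 2)) :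
    (K ⊗ₖ (1 : Matrix κ κ ℂ)) * conjSqrt ω J * (K ⊗ₖ (1 : Matrix κ κ ℂ))ᴴ = conjSqrt τ J := by
  have h1 : (K ⊗ₖ (1 : Matrix κ κ ℂ)) * (psdPow ω (1 / 2) ⊗ₖ (1 : Matrix κ κ ℂ)) =
      psdPow τ (1 / 2) ⊗ₖ (1 : Matrix κ κ ℂ) := by
    rw [← Matrix.mul_kronecker_mul, hK, Matrix.mul_one]
  have h2 : (psdPow ω (1 / 2) ⊗ₖ (1 : Matrix κ κ ℂ)) * (K ⊗ₖ (1 : Matrix κ κ ℂ))ᴴ =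
      psdPow τ (1 / 2) ⊗ₖ (1 : Matrix κ κ ℂ) := by
    have := congrArg Matrix.conjTranspose h1
    simpa only [Matrix.conjTranspose_mul, Matrix.conjTranspose_kronecker, psdPow_conjTranspose,
      Matrix.conjTranspose_one] using this
  rw [conjSqrt, conjSqrt]
  calc _ = ((K ⊗ₖ (1 : Matrix κ κ ℂ)) * (psdPow ω (1 / 2) ⊗ₖ (1 : Matrix κ κ ℂ))) * J *
        ((psdPow ω (1 / 2) ⊗ₖ (1 : Matrix κ κ ℂ)) * (K ⊗ₖ (1 : Matrix κ κ ℂ))ᴴ) := by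
        simp only [Matrix.mul_assoc]
    _ = _ := by rw [h1, h2]

/-- Domination puts the support of `τ` inside that of `ω`, so the support projection of `ω` acts
trivially on `τ^{1/2}`. It permits recovering `τ^{1/2}` from `ω^{1/2}` although `ω` may be singular.
-/
theorem psdPow_half_mul_of_loewnerLE {ω τ : Matrix ι ι ℂ} (hω : ω.PosSemidef) (hτ : τ.PosSemidef)
    {c : ℝ} (h : LoewnerLE τ ((c : ℂ) • ω)) :
    psdPow τ (1 / 2) * psdPow ω (-(1 / 2)) * psdPow ω (1 / 2) = psdPow τ (1 / 2) := by
  have hP : psdPow ω (-(1 / 2)) * psdPow ω (1 / 2) = ω * psdPow ω (-1) := by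
    obtain ⟨U, hU, d, hd, rfl⟩ := exists_spec_posSemidef hω
    simp only [psdPow_spec hU, spec_mul hU]
    congr 1
    ext i
    rcases (hd i).eq_or_lt with h | h
    · rw [← h]; norm_num
    · rw [← Real.rpow_add h, Real.rpow_neg_one, mul_inv_cancel₀ h.ne']; norm_num
  have hs : SuppLE τ ω :=
    suppLE_of_loewnerLE_psdPow hτ hω (p := 1) one_ne_zero (by rwa [psdPow_one hω.1])
  rw [suppLE_iff hω, ← hP] at hs
  set P := psdPow ω (-(1 / 2)) * psdPow ω (1 / 2) with hPdef
  have h1 : (1 - P) * psdPow τ (1 / 2) = 0 := by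
    rw [← Matrix.self_mul_conjTranspose_eq_zero, Matrix.conjTranspose_mul, psdPow_conjTranspose,
      Matrix.mul_assoc, ← Matrix.mul_assoc (psdPow τ _), psdPow_half_mul_half hτ,
      ← Matrix.mul_assoc, Matrix.sub_mul, hs, Matrix.one_mul, sub_self, Matrix.zero_mul]
  rw [Matrix.sub_mul, Matrix.one_mul, sub_eq_zero] at h1
  have h2 := congrArg Matrix.conjTranspose h1
  have hPH : Pᴴ = P := by
    have hc : ω * psdPow ω (-1) = psdPow ω (-1) * ω :=
      (psdPow_intertwine hω.1 hω.1 rfl (-1)).symm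
    rw [hP, Matrix.conjTranspose_mul, psdPow_conjTranspose, hω.1.eq, hc]
  rw [Matrix.conjTranspose_mul, psdPow_conjTranspose, hPH] at h2
  rw [Matrix.mul_assoc, ← hPdef, ← h2]

end Permutations

/-! ### Reduction to permutation-invariant input states -/

section Symmetrization

variable {ι κ : Type*} [Fintype ι] [DecidableEq ι] [Fintype κ] [DecidableEq κ]
  {G : Type*} [Group G] [Fintype G] (φ : G →* Equiv.Perm ι) (ψ : G →* Equiv.Perm κ)

/-- The average of `ω` over the action of `G`. -/
def symmetrize (ω : Matrix ι ι ℂ) : Matrix ι ι ℂ :=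
  (((Fintype.card G : ℝ)⁻¹ : ℝ) : ℂ) • ∑ g, ω.submatrix (φ g) (φ g)

theorem card_smul_symmetrize (ω : Matrix ι ι ℂ) :
    (((Fintype.card G : ℝ)) : ℂ) • symmetrize φ ω = ∑ g, ω.submatrix (φ g) (φ g) := by
  rw [symmetrize, smul_smul, ← Complex.ofReal_mul, mul_inv_cancel₀ (by simp), Complex.ofReal_one,
    one_smul]

theorem symmetrize_posSemidef {ω : Matrix ι ι ℂ} (hω : ω.PosSemidef) :
    (symmetrize φ ω).PosSemidef :=
  (Matrix.posSemidef_sum _ fun _ _ => hω.submatrix _).smul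
    (by exact_mod_cast inv_nonneg.2 (Nat.cast_nonneg (α := ℝ) _))

theorem symmetrize_trace (ω : Matrix ι ι ℂ) : (symmetrize φ ω).trace = ω.trace := by
  have h : ∀ g, (ω.submatrix (φ g) (φ g)).trace = ω.trace := fun g =>
    Equiv.sum_comp (φ g) fun i => ω i i
  rw [symmetrize, Matrix.trace_smul, Matrix.trace_sum]
  simp [h]

theorem symmetrize_submatrix (ω : Matrix ι ι ℂ) (h : G) :
    (symmetrize φ ω).submatrix (φ h) (φ h) = symmetrize φ ω := by
  ext i j
  simp only [symmetrize, Matrix.submatrix_apply, Matrix.smul_apply, Matrix.sum_apply]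
  congr 1
  refine Fintype.sum_equiv (Equiv.mulRight h) _ _ fun g => ?_
  simp

/-- Write `ω_g` for the translate of `ω` by `g`. The operator `ω_g^{1/2} τ^{-1/2}` converts
`τ^{1/2}` into `ω_g^{1/2}`, and by invariance of `J₁` and `J₂` a permutation unitary then undoes `g`
on both operators at once. The squares of these operators sum to `|G|` times a projection, as the
`ω_g` sum to `|G| τ`. -/
theorem sharpQ_le_symmetrize {α : ℝ} (hα : 1 < α) {J₁ J₂ : Matrix (ι × κ) (ι × κ) ℂ}
    (hJ₂ : J₂.PosSemidef)
    (h₁ : ∀ g, J₁.submatrix ((φ g).prodCongr (ψ g)) ((φ g).prodCongr (ψ g)) = J₁)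
    (h₂ : ∀ g, J₂.submatrix ((φ g).prodCongr (ψ g)) ((φ g).prodCongr (ψ g)) = J₂)
    {ω : Matrix ι ι ℂ} (hω : ω.PosSemidef) :
    sharpQ α (conjSqrt ω J₁) (conjSqrt ω J₂) ≤
      sharpQ α (conjSqrt (symmetrize φ ω) J₁) (conjSqrt (symmetrize φ ω) J₂) := by
  set τ := symmetrize φ ω with hτ
  have hτp : τ.PosSemidef := symmetrize_posSemidef φ hω
  have hωp : ∀ g, (ω.submatrix (φ g) (φ g)).PosSemidef := fun g => hω.submatrix _
  let R : G → Matrix (ι × κ) (ι × κ) ℂ := fun g => permMat ((φ g).prodCongr (ψ g))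
  have hR : ∀ g, R g ∈ Matrix.unitaryGroup _ ℂ := fun g => permMat_mem _
  let K : G → Matrix ι ι ℂ := fun g => psdPow (ω.submatrix (φ g) (φ g)) (1 / 2) * psdPow τ (-(1 / 2))
  have hle : ∀ g, LoewnerLE (ω.submatrix (φ g) (φ g)) (((Fintype.card G : ℝ) : ℂ) • τ) := by
    classical
    intro g
    rw [card_smul_symmetrize, LoewnerLE, ← Finset.add_sum_erase _ _ (Finset.mem_univ g),
      add_sub_cancel_left]
    exact Matrix.posSemidef_sum _ fun g _ => hωp g
  have hK : ∀ g, K g * psdPow τ (1 / 2) = psdPow (ω.submatrix (φ g) (φ g)) (1 / 2) := fun g =>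
    psdPow_half_mul_of_loewnerLE hτp (hωp g) (hle g)
  have hconj : ∀ (J : Matrix (ι × κ) (ι × κ) ℂ) (g : G),
      J.submatrix ((φ g).prodCongr (ψ g)) ((φ g).prodCongr (ψ g)) = J →
      ((R g)ᴴ * (K g ⊗ₖ (1 : Matrix κ κ ℂ))) * conjSqrt τ J *
        ((R g)ᴴ * (K g ⊗ₖ (1 : Matrix κ κ ℂ)))ᴴ = conjSqrt ω J := by
    intro J g hJ
    have h3 : conjSqrt (ω.submatrix (φ g) (φ g)) J = R g * conjSqrt ω J * (R g)ᴴ := by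
      conv_lhs => rw [← hJ]
      rw [conjSqrt_submatrix hω.1, permMat_mul_mul]
    rw [Matrix.conjTranspose_mul, Matrix.conjTranspose_conjTranspose]
    calc _ = (R g)ᴴ * ((K g ⊗ₖ (1 : Matrix κ κ ℂ)) * conjSqrt τ J *
          (K g ⊗ₖ (1 : Matrix κ κ ℂ))ᴴ) * R g := by simp only [Matrix.mul_assoc]
      _ = ((R g)ᴴ * R g) * conjSqrt ω J * ((R g)ᴴ * R g) := by
          rw [kronecker_mul_conjSqrt J (hK g), h3]; simp only [Matrix.mul_assoc]
      _ = conjSqrt ω J := by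
          rw [unitary_conjTranspose_mul (hR g), Matrix.one_mul, Matrix.mul_one]
  refine sharpQ_le_of_conj_family hα (conjSqrt_posSemidef hJ₂ τ)
    (fun g => (R g)ᴴ * (K g ⊗ₖ (1 : Matrix κ κ ℂ))) (fun g => hconj J₁ g (h₁ g))
    (fun g => hconj J₂ g (h₂ g)) ?_
  have hKK : ∑ g, (K g)ᴴ * K g =
      ((Fintype.card G : ℝ) : ℂ) • (psdPow τ (-(1 / 2)) * τ * psdPow τ (-(1 / 2))) := by
    have : ∀ g, (K g)ᴴ * K g =
        psdPow τ (-(1 / 2)) * ω.submatrix (φ g) (φ g) * psdPow τ (-(1 / 2)) := by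
      intro g
      simp only [K]
      rw [Matrix.conjTranspose_mul, psdPow_conjTranspose, psdPow_conjTranspose, Matrix.mul_assoc,
        ← Matrix.mul_assoc (psdPow (ω.submatrix _ _) _), psdPow_half_mul_half (hωp g),
        Matrix.mul_assoc]
    simp only [this]
    rw [← Finset.sum_mul, ← Finset.mul_sum, ← card_smul_symmetrize, Matrix.mul_smul,
      Matrix.smul_mul]
  -- The left side is the support projection of `τ`, which need not be the identity.
  have hproj : LoewnerLE (psdPow τ (-(1 / 2)) * τ * psdPow τ (-(1 / 2))) 1 := by
    obtain ⟨U, hU, d, hd, hτd⟩ := exists_spec_posSemidef hτp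
    have h1 : (1 : Matrix ι ι ℂ) = spec U (fun _ => 1) := by rw [spec_const hU]; simp
    have h2 : psdPow τ (-(1 / 2)) * τ * psdPow τ (-(1 / 2)) + spec U (fun i =>
        1 - d i ^ (-(1 / 2) : ℝ) * d i * d i ^ (-(1 / 2) : ℝ)) = 1 := by
      rw [h1, hτd, psdPow_spec hU, spec_mul hU, spec_mul hU, spec_add]
      congr 1
      ext i
      ring
    rw [LoewnerLE, ← h2, add_sub_cancel_left]
    refine spec_posSemidef U fun i => ?_
    rcases (hd i).eq_or_lt with h | h
    · rw [← h]; norm_num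
    · rw [mul_right_comm, ← Real.rpow_add h, show (-(1 / 2) + -(1 / 2) : ℝ) = -1 by norm_num,
        Real.rpow_neg_one, inv_mul_cancel₀ h.ne', sub_self]
  have hsum : ∑ g, ((R g)ᴴ * (K g ⊗ₖ (1 : Matrix κ κ ℂ)))ᴴ * ((R g)ᴴ * (K g ⊗ₖ (1 : Matrix κ κ ℂ))) =
      (∑ g, (K g)ᴴ * K g) ⊗ₖ (1 : Matrix κ κ ℂ) := by
    have h4 : ∀ g, ((R g)ᴴ * (K g ⊗ₖ (1 : Matrix κ κ ℂ)))ᴴ * ((R g)ᴴ * (K g ⊗ₖ (1 : Matrix κ κ ℂ))) =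
        ((K g)ᴴ * K g) ⊗ₖ (1 : Matrix κ κ ℂ) := by
      intro g
      rw [Matrix.conjTranspose_mul, Matrix.conjTranspose_conjTranspose, Matrix.mul_assoc,
        ← Matrix.mul_assoc (R g), unitary_mul_conjTranspose (hR g), Matrix.one_mul,
        Matrix.conjTranspose_kronecker, ← Matrix.mul_kronecker_mul, Matrix.conjTranspose_one,
        Matrix.mul_one]
    simp only [h4]
    ext p q
    simp [Matrix.kroneckerMap_apply, Matrix.sum_apply, Finset.sum_mul]
  rw [hsum, hKK, Matrix.smul_kronecker, LoewnerLE, ← smul_sub]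
  refine Matrix.PosSemidef.smul ?_ (by exact_mod_cast Nat.cast_nonneg (α := ℝ) _)
  rw [← Matrix.one_kronecker_one (m := ι) (n := κ)]
  have h5 := Matrix.PosSemidef.kronecker hproj (Matrix.PosSemidef.one (n := κ) (R := ℂ))
  have h6 : ∀ M : Matrix ι ι ℂ, (1 - M) ⊗ₖ (1 : Matrix κ κ ℂ) =
      (1 : Matrix ι ι ℂ) ⊗ₖ (1 : Matrix κ κ ℂ) - M ⊗ₖ (1 : Matrix κ κ ℂ) := by
    intro M
    ext p q
    simp only [Matrix.kroneckerMap_apply, Matrix.sub_apply, sub_mul]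
  rw [← h6]
  exact h5

end Symmetrization

/-! ### Counting the eigenvalues of a permutation-invariant matrix -/

section Counting

/-- The number of occurrences of each value of `f`. -/
def occ {n : ℕ} {T : Type*} [DecidableEq T] (f : Fin n → T) : T → Fin (n + 1) := fun t =>
  ⟨Fintype.card {i // f i = t}, Nat.lt_succ_of_le ((Fintype.card_subtype_le _).trans (by simp))⟩

theorem exists_perm_of_occ_eq {n : ℕ} {T : Type*} [DecidableEq T] {f g : Fin n → T}
    (h : occ f = occ g) : ∃ π : Equiv.Perm (Fin n), ∀ i, g (π i) = f i := by
  have he : ∀ t, Nonempty ({i // f i = t} ≃ {i // g i = t}) := fun t =>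
    Fintype.card_eq.1 (congrArg Fin.val (congrFun h t))
  exact ⟨Equiv.ofFiberEquiv fun t => (he t).some, fun i => Equiv.ofFiberEquiv_map _ i⟩

/-- The spectral projections of distinct eigenvalues are linearly independent, and their entries are
constant on the fibres of `c`, so they lie in the image of a space of dimension `|K|`. -/
theorem card_eigenvalues_le_of_range {ι : Type*} [Fintype ι] [DecidableEq ι] {K : Type*} [Fintype K]
    (c : ι × ι → K) {σ : Matrix ι ι ℂ}
    (hc : ∀ f : ℝ → ℝ, ∀ p q, c p = c q → cfc f σ p.1 p.2 = cfc f σ q.1 q.2)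
    {U : Matrix ι ι ℂ} (hU : U ∈ Matrix.unitaryGroup ι ℂ) {d : ι → ℝ} (hσ : σ = spec U d) :
    (Finset.univ.image d).card ≤ Fintype.card K := by
  let Φ : (K → ℂ) →ₗ[ℂ] Matrix ι ι ℂ :=
    { toFun := fun v => Matrix.of fun i j => v (c (i, j))
      map_add' := fun _ _ => rfl
      map_smul' := fun _ _ => rfl }
  let E : ℝ → Matrix ι ι ℂ := fun t => cfc (fun s : ℝ => if s = t then (1 : ℝ) else 0) σ
  -- The value `0` off the range of `c` is arbitrary, since `Φ` never reads it.
  let v : ℝ → K → ℂ := fun t => Function.extend c (fun p => E t p.1 p.2) 0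
  have hv : ∀ t, Φ (v t) = E t := by
    intro t
    have hf : Function.FactorsThrough (fun p : ι × ι => E t p.1 p.2) c := fun p q h => hc _ p q h
    ext i j
    exact hf.extend_apply 0 (i, j)
  have hind : LinearIndependent ℂ fun t : (Finset.univ.image d : Finset ℝ) => E t := by
    rw [Fintype.linearIndependent_iff]
    intro g hg t
    obtain ⟨i, -, hi⟩ := Finset.mem_image.1 t.2
    have h1 := congrArg (fun M => (Uᴴ * M * U) i i) hg
    have h2 : ∀ t, Uᴴ * E t * U = Matrix.diagonal fun i => (((if d i = t then 1 else 0 : ℝ)) : ℂ) := by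
      intro t
      simp only [E]
      rw [hσ, cfc_spec hU, spec, Matrix.mul_assoc, Matrix.mul_assoc, unitary_conjTranspose_mul hU,
        Matrix.mul_one, ← Matrix.mul_assoc, unitary_conjTranspose_mul hU, Matrix.one_mul]
    simp only [Finset.mul_sum, Finset.sum_mul, Matrix.mul_smul, Matrix.smul_mul, h2,
      Matrix.sum_apply, Matrix.smul_apply, Matrix.diagonal_apply_eq, Matrix.mul_zero,
      Matrix.zero_mul, Matrix.zero_apply] at h1
    rw [Finset.sum_eq_single t] at h1
    · simpa [hi] using h1
    · intro s _ hs
      have : d i ≠ s := fun h => hs (Subtype.ext (h.symm.trans hi))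
      simp [this]
    · intro h; exact absurd (Finset.mem_univ _) h
  have hind' : LinearIndependent ℂ fun t : (Finset.univ.image d : Finset ℝ) => v t := by
    refine LinearIndependent.of_comp Φ ?_
    simpa only [Function.comp_def, hv] using hind
  have := hind'.fintype_card_le_finrank
  simpa using this

variable {X Y : Type*} [Fintype X] [DecidableEq X] [Fintype Y] [DecidableEq Y]

/-- The action of permutations on the tuples with entries in `X`. -/
def permTuple (n : ℕ) (X : Type*) : Equiv.Perm (Fin n) →* Equiv.Perm (Fin n → X) where
  toFun π := Equiv.arrowCongr π (Equiv.refl X)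
  map_one' := rfl
  map_mul' _ _ := rfl

/-- Functions of `σ` inherit its invariance, so an entry depends only on how often each of the
`(|X||Y|)^2` pairs of symbols occurs along the zipped index sequence. Each count lies between `0`
and `n`. -/
theorem card_eigenvalues_le {n : ℕ}
    {σ : Matrix ((Fin n → X) × (Fin n → Y)) ((Fin n → X) × (Fin n → Y)) ℂ} (hσ : σ.IsHermitian)
    (hinv : ∀ π : Equiv.Perm (Fin n),
      σ.submatrix ((permTuple n X π).prodCongr (permTuple n Y π))
        ((permTuple n X π).prodCongr (permTuple n Y π)) = σ)
    {U : Matrix ((Fin n → X) × (Fin n → Y)) ((Fin n → X) × (Fin n → Y)) ℂ}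
    (hU : U ∈ Matrix.unitaryGroup _ ℂ) {d : (Fin n → X) × (Fin n → Y) → ℝ} (hd : σ = spec U d) :
    (Finset.univ.image d).card ≤ (n + 1) ^ ((Fintype.card X * Fintype.card Y) ^ 2) := by
  let zip : ((Fin n → X) × (Fin n → Y)) × ((Fin n → X) × (Fin n → Y)) →
      Fin n → (X × Y) × (X × Y) :=
    fun p i => ((p.1.1 i, p.1.2 i), (p.2.1 i, p.2.2 i))
  have := card_eigenvalues_le_of_range (fun p => occ (zip p)) (σ := σ) ?_ hU hd
  · refine this.trans (le_of_eq ?_)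
    simp [sq]
  · intro f p q hpq
    obtain ⟨π, hπ⟩ := exists_perm_of_occ_eq hpq
    set e := (permTuple n X π).prodCongr (permTuple n Y π) with he
    have hcomm : (cfc f σ).submatrix e e = cfc f σ := by
      have hP := permMat_mem e
      have h1 : σ * permMat e = permMat e * σ := by
        have h2 := permMat_mul_mul e σ
        rw [hinv π] at h2
        rw [← h2]
        conv_lhs => rw [Matrix.mul_assoc, unitary_conjTranspose_mul hP, Matrix.mul_one]
        rw [h2]
      have h3 := cfc_intertwine hσ hσ h1 f
      rw [← permMat_mul_mul, ← h3, Matrix.mul_assoc, unitary_mul_conjTranspose hP, Matrix.mul_one]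
    have e1 : e p.1 = q.1 := by
      refine Prod.ext (funext fun i => ?_) (funext fun i => ?_)
      · have := congrArg (fun t => t.1.1) (hπ (π.symm i))
        simp only [zip, Equiv.apply_symm_apply] at this
        exact this.symm
      · have := congrArg (fun t => t.1.2) (hπ (π.symm i))
        simp only [zip, Equiv.apply_symm_apply] at this
        exact this.symm
    have e2 : e p.2 = q.2 := by
      refine Prod.ext (funext fun i => ?_) (funext fun i => ?_)
      · have := congrArg (fun t => t.2.1) (hπ (π.symm i))
        simp only [zip, Equiv.apply_symm_apply] at this
        exact this.symm
      · have := congrArg (fun t => t.2.2) (hπ (π.symm i))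
        simp only [zip, Equiv.apply_symm_apply] at this
        exact this.symm
    rw [← e1, ← e2]
    exact (congrFun (congrFun hcomm p.1) p.2).symm

end Counting

/-! ### Choi matrices of completely positive maps and of tensor powers -/

section Choi

variable {X Y : Type*} [Fintype X] [DecidableEq X] [Fintype Y] [DecidableEq Y]

theorem choi_apply (N : Matrix X X ℂ →ₗ[ℂ] Matrix Y Y ℂ) (p q : X × Y) :
    choi N p q = N (Matrix.single p.1 q.1 1) p.2 q.2 := by
  have h : (Matrix.of fun x x' => maxEnt X (p.1, x) (q.1, x')) = Matrix.single p.1 q.1 (1 : ℂ) := by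
    ext a b
    simp only [maxEnt, Matrix.of_apply, Matrix.sum_apply, Matrix.kroneckerMap_apply]
    rw [Finset.sum_eq_single p.1, Finset.sum_eq_single q.1]
    · simp
    · intro x _ hx; simp [Matrix.single_apply, hx]
    · simp
    · intro x _ hx; simp [Matrix.single_apply, hx]
    · simp
  change N (Matrix.of fun x x' => maxEnt X (p.1, x) (q.1, x')) p.2 q.2 = _
  rw [h]

open scoped MatrixOrder Matrix.Norms.L2Operator in
theorem choi_posSemidef {N : Matrix X X ℂ →ₗ[ℂ] Matrix Y Y ℂ} (hN : IsCP N) :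
    (choi N).PosSemidef := by
  obtain ⟨F, rfl⟩ := hN
  rcases isEmpty_or_nonempty X with hX | ⟨⟨x₀⟩⟩
  · have : choi F.toLinearMap = 0 := by ext p; exact isEmptyElim p.1
    rw [this]
    exact Matrix.PosSemidef.zero
  -- A single nonzero row `|x₀⟩⟨x|` gives `(star R * R) x x' = |x⟩⟨x'|`. The block matrix of matrix
  -- units is therefore nonnegative, and complete positivity applies to it.
  let R : CStarMatrix X X (Matrix X X ℂ) := CStarMatrix.ofMatrix (Matrix.of fun k x =>
    if k = x₀ then Matrix.single x₀ x 1 else 0)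
  have hRa : ∀ k x, R k x = if k = x₀ then Matrix.single x₀ x 1 else 0 := fun _ _ => rfl
  have hR : ∀ x x', (star R * R) x x' = Matrix.single x x' (1 : ℂ) := by
    intro x x'
    rw [CStarMatrix.mul_apply, Finset.sum_eq_single x₀]
    · rw [CStarMatrix.star_apply, hRa, hRa, if_pos rfl, if_pos rfl, Matrix.star_eq_conjTranspose,
        Matrix.conjTranspose_single]
      simp
    · intro k _ hk
      rw [hRa k x', if_neg hk, mul_zero]
    · simp
  have hpsd : ∀ G : CStarMatrix X X (Matrix Y Y ℂ), 0 ≤ G →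
      (Matrix.of fun p q : X × Y => G p.1 q.1 p.2 q.2).PosSemidef := by
    intro G hG
    rw [StarOrderedRing.nonneg_iff] at hG
    induction hG using AddSubmonoid.closure_induction with
    | mem G hG =>
      obtain ⟨S, rfl⟩ := hG
      have h : (Matrix.of fun p q : X × Y => (star S * S) p.1 q.1 p.2 q.2) =
          ∑ k, (Matrix.of fun (z : Y) (p : X × Y) => S k p.1 z p.2)ᴴ *
            (Matrix.of fun (z : Y) (p : X × Y) => S k p.1 z p.2) := by
        ext p q
        rw [Matrix.of_apply, CStarMatrix.mul_apply, Matrix.sum_apply, Matrix.sum_apply]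
        rfl
      rw [h]
      exact Matrix.posSemidef_sum _ fun k _ => Matrix.posSemidef_conjTranspose_mul_self _
    | zero => exact Matrix.PosSemidef.zero
    | add G H _ _ hG hH => exact hG.add hH
  have h1 : (0 : CStarMatrix X X (Matrix Y Y ℂ)) ≤ (star R * R).map F :=
    CompletelyPositiveMap.map_cstarMatrix_nonneg F _ (star_mul_self_nonneg R)
  convert hpsd _ h1 using 1
  ext p q
  rw [choi_apply, Matrix.of_apply, CStarMatrix.map_apply, hR]
  rfl

theorem choi_tensorPow_apply (n : ℕ) (N : Matrix X X ℂ →ₗ[ℂ] Matrix Y Y ℂ)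
    (p q : (Fin n → X) × (Fin n → Y)) :
    choi (tensorPow n N) p q = ∏ i, choi N (p.1 i, p.2 i) (q.1 i, q.2 i) := by
  rw [choi_apply]
  simp only [choi_apply]
  change ∑ x : Fin n → X, ∑ x' : Fin n → X, Matrix.single p.1 q.1 (1 : ℂ) x x' *
    ∏ i, N (Matrix.single (x i) (x' i) 1) (p.2 i) (q.2 i) = _
  rw [Finset.sum_eq_single p.1, Finset.sum_eq_single q.1]
  · simp
  · intro x _ hx; simp [hx.symm]
  · simp
  · intro x _ hx; simp [hx.symm]
  · simp

theorem choi_tensorPow_submatrix (n : ℕ) (N : Matrix X X ℂ →ₗ[ℂ] Matrix Y Y ℂ)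
    (π : Equiv.Perm (Fin n)) :
    (choi (tensorPow n N)).submatrix ((permTuple n X π).prodCongr (permTuple n Y π))
      ((permTuple n X π).prodCongr (permTuple n Y π)) = choi (tensorPow n N) := by
  ext p q
  rw [Matrix.submatrix_apply, choi_tensorPow_apply, choi_tensorPow_apply]
  exact Equiv.prod_comp π.symm fun i => choi N (p.1 i, p.2 i) (q.1 i, q.2 i)

/-- A factorization `Bᴴ * B` of the one-copy Choi matrix tensorizes entrywise, so complete
positivity of the tensor power is not needed. -/
theorem choi_tensorPow_posSemidef (n : ℕ) {N : Matrix X X ℂ →ₗ[ℂ] Matrix Y Y ℂ} (hN : IsCP N) :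
    (choi (tensorPow n N)).PosSemidef := by
  have hJ := choi_posSemidef hN
  set B := psdPow (choi N) (1 / 2) with hB
  have hBB : choi N = Bᴴ * B := by
    rw [hB, psdPow_conjTranspose, psdPow_half_mul_half hJ]
  let C : Matrix (Fin n → X × Y) ((Fin n → X) × (Fin n → Y)) ℂ := Matrix.of fun z p =>
    ∏ i, B (z i) (p.1 i, p.2 i)
  have h : choi (tensorPow n N) = Cᴴ * C := by
    ext p q
    rw [choi_tensorPow_apply, hBB, Matrix.mul_apply]
    simp only [Matrix.mul_apply, Finset.prod_univ_sum, Fintype.piFinset_univ,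
      Finset.prod_mul_distrib, Matrix.conjTranspose_apply, C, Matrix.of_apply, star_prod]
  rw [h]
  exact Matrix.posSemidef_conjTranspose_mul_self C

end Choi

/-! ### Extended logarithms and arithmetic in `EReal` -/

section Logarithm

theorem log2_mono {x y : ℝ≥0∞} (h : x ≤ y) : log2 x ≤ log2 y := by
  unfold log2
  by_cases hx : x = 0
  · simp [hx]
  have hy : y ≠ 0 := fun hy => hx (le_antisymm (hy ▸ h) bot_le)
  by_cases hy' : y = ⊤
  · simp [hy']
  have hx' : x ≠ ⊤ := fun hx' => hy' (top_le_iff.1 (hx' ▸ h))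
  rw [if_neg hx, if_neg hy, if_neg hx', if_neg hy', EReal.coe_le_coe_iff]
  exact Real.logb_le_logb_of_le one_lt_two (ENNReal.toReal_pos hx hx') (ENNReal.toReal_mono hy' h)

theorem log2_ofReal_mul {a : ℝ} (ha : 0 < a) (x : ℝ≥0∞) :
    log2 (ENNReal.ofReal a * x) = log2 x + (Real.logb 2 a : ℝ) := by
  have ha' : ENNReal.ofReal a ≠ 0 := by simpa using ha
  unfold log2
  by_cases hx : x = 0
  · simp [hx]
  by_cases hx' : x = ⊤
  · simp [hx', ENNReal.mul_top ha']
  rw [if_neg (mul_ne_zero ha' hx), if_neg hx, if_neg (ENNReal.mul_ne_top ENNReal.ofReal_ne_top hx'),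
    if_neg hx', ← EReal.coe_add, ENNReal.toReal_mul, ENNReal.toReal_ofReal ha.le,
    Real.logb_mul ha.ne' (ENNReal.toReal_pos hx hx').ne', add_comm]

theorem coe_mul_add_coe {r : ℝ} (hr : 0 < r) (x : EReal) (c : ℝ) :
    (r : EReal) * (x + (c : EReal)) = (r : EReal) * x + ((r * c : ℝ) : EReal) := by
  induction x with
  | bot => rw [EReal.bot_add, EReal.coe_mul_bot_of_pos hr, EReal.bot_add]
  | top => rw [EReal.top_add_coe, EReal.coe_mul_top_of_pos hr, EReal.top_add_coe]
  | coe x => rw [← EReal.coe_add, ← EReal.coe_mul, ← EReal.coe_mul, ← EReal.coe_add, mul_add]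

theorem coe_mul_le_coe_mul {r : ℝ} (hr : 0 ≤ r) {x y : EReal} (h : x ≤ y) :
    (r : EReal) * x ≤ (r : EReal) * y :=
  mul_le_mul_of_nonneg_left h (EReal.coe_nonneg.2 hr)

end Logarithm

/-! ### Channel divergences and the size of the error term -/

section ChannelDivergence

variable {X Y : Type*} [Fintype X] [DecidableEq X] [Fintype Y] [DecidableEq Y] {α : ℝ}

theorem sharpD_le_sandwichedD_add {ι : Type*} [Fintype ι] [DecidableEq ι] (hα : 1 < α)
    {ρ σ ρ' σ' : Matrix ι ι ℂ} {v : ℕ} (hv : 0 < v)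
    (h : sharpQ α ρ σ ≤ ENNReal.ofReal ((v : ℝ) ^ α) * sandwichedQ α ρ' σ') :
    sharpD α ρ σ ≤ sandwichedD α ρ' σ' + ((α / (α - 1) * Real.logb 2 v : ℝ) : EReal) := by
  have hr : 0 < 1 / (α - 1) := one_div_pos.2 (by linarith)
  have hv' : (0 : ℝ) < v := by exact_mod_cast hv
  have h1 := log2_mono h
  rw [log2_ofReal_mul (Real.rpow_pos_of_pos hv' α)] at h1
  refine (coe_mul_le_coe_mul hr.le h1).trans (le_of_eq ?_)
  rw [coe_mul_add_coe hr, Real.logb_rpow_eq_mul_logb_of_pos hv', sandwichedD]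
  congr 2
  ring

theorem sandwichedD_le_sharpD {ι : Type*} [Fintype ι] [DecidableEq ι] (hα : 1 < α)
    {ρ σ : Matrix ι ι ℂ} (hρ : ρ.PosSemidef) (hσ : σ.PosSemidef) :
    sandwichedD α ρ σ ≤ sharpD α ρ σ :=
  coe_mul_le_coe_mul (one_div_nonneg.2 (by linarith)) (log2_mono (sandwichedQ_le_sharpQ hα hρ hσ))

theorem channelDiv_sandwichedD_le (hα : 1 < α) (n : ℕ) {N M : Matrix X X ℂ →ₗ[ℂ] Matrix Y Y ℂ}
    (hN : IsCP N) (hM : IsCP M) :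
    channelDiv (sandwichedD α) (tensorPow n N) (tensorPow n M) ≤
      channelDiv (sharpD α) (tensorPow n N) (tensorPow n M) :=
  iSup₂_mono fun ω _ => iSup_mono fun _ => sandwichedD_le_sharpD hα
    (conjSqrt_posSemidef (choi_tensorPow_posSemidef n hN) ω)
    (conjSqrt_posSemidef (choi_tensorPow_posSemidef n hM) ω)

theorem channelDiv_sharpD_le (hα : 1 < α) (n : ℕ) {N M : Matrix X X ℂ →ₗ[ℂ] Matrix Y Y ℂ}
    (hN : IsCP N) (hM : IsCP M) :
    channelDiv (sharpD α) (tensorPow n N) (tensorPow n M) ≤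
      channelDiv (sandwichedD α) (tensorPow n N) (tensorPow n M) +
        ((α / (α - 1) * Real.logb 2
          (((n + 1) ^ ((Fintype.card X * Fintype.card Y) ^ 2) : ℕ) : ℝ) : ℝ) : EReal) := by
  have hJN := choi_tensorPow_posSemidef n hN
  have hJM := choi_tensorPow_posSemidef n hM
  refine iSup₂_le fun ω hω => iSup_le fun hω1 => ?_
  have hτ := symmetrize_posSemidef (permTuple n X) hω
  set τ := symmetrize (permTuple n X) ω with hτdef
  have hv : 0 < (n + 1) ^ ((Fintype.card X * Fintype.card Y) ^ 2) := by positivity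
  have hσ := conjSqrt_posSemidef hJM τ
  have hQ := (sharpQ_le_symmetrize (permTuple n X) (permTuple n Y) hα hJM
    (choi_tensorPow_submatrix n N) (choi_tensorPow_submatrix n M) hω).trans
    (sharpQ_le_mul_sandwichedQ hα (conjSqrt_posSemidef hJN τ) hσ hv fun U hU d hd =>
      card_eigenvalues_le hσ.1 (fun π => by
        have h1 := conjSqrt_submatrix hτ.1 (choi (tensorPow n M)) (permTuple n X π) (permTuple n Y π)
        rw [symmetrize_submatrix, choi_tensorPow_submatrix] at h1
        exact h1.symm) hU hd)
  refine (sharpD_le_sandwichedD_add hα hv hQ).trans (add_le_add_left ?_ _)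
  -- The sandwiched supremum is tested at the symmetrized state, whatever the input `ω` was.
  exact le_iSup₂_of_le τ hτ (le_iSup_of_le ((symmetrize_trace _ ω).trans hω1) le_rfl)

/-- For `d ≥ 1` one has `n + 1 ≤ n + d`, and the extra `d log(n + d)` is nonnegative; for `d = 0`
both sides vanish. -/
theorem logb_pow_le {n d : ℕ} (hn : 1 ≤ n) :
    Real.logb 2 (((n + 1) ^ (d ^ 2) : ℕ) : ℝ) ≤
      ((d : ℝ) ^ 2 + (d : ℝ)) * Real.logb 2 ((n : ℝ) + (d : ℝ)) := by
  have hn' : (1 : ℝ) ≤ n := by exact_mod_cast hn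
  push_cast
  rw [Real.logb_pow]
  push_cast
  rcases Nat.eq_zero_or_pos d with rfl | hd
  · simp
  have hd' : (1 : ℝ) ≤ d := by exact_mod_cast hd
  have h1 : Real.logb 2 ((n : ℝ) + 1) ≤ Real.logb 2 ((n : ℝ) + d) :=
    Real.logb_le_logb_of_le one_lt_two (by linarith) (by linarith)
  have h2 : 0 ≤ Real.logb 2 ((n : ℝ) + d) := Real.logb_nonneg one_lt_two (by linarith)
  nlinarith [mul_le_mul_of_nonneg_left h1 (sq_nonneg (d : ℝ)), mul_nonneg (by linarith : (0 : ℝ) ≤ d) h2]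

end ChannelDivergence

end QDiv
end

theorem lemma3p5 {X Y : Type*} [Fintype X] [DecidableEq X] [Fintype Y] [DecidableEq Y]
    (N M : Matrix X X ℂ →ₗ[ℂ] Matrix Y Y ℂ) (hN : QDiv.IsCP N) (hM : QDiv.IsCP M)
    (n : ℕ) (hn : 1 ≤ n) (α : ℝ) (hα : 1 < α)
    (d : ℕ) (hd : d = Fintype.card X * Fintype.card Y) :
    ((1 / (n : ℝ) : ℝ) : EReal) *
          QDiv.channelDiv (QDiv.sharpD α) (QDiv.tensorPow n N) (QDiv.tensorPow n M) -
        ((1 / (n : ℝ) * (α / (α - 1)) * ((d : ℝ) ^ 2 + (d : ℝ)) *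
          Real.logb 2 ((n : ℝ) + (d : ℝ)) : ℝ) : EReal) ≤
      ((1 / (n : ℝ) : ℝ) : EReal) *
        QDiv.channelDiv (QDiv.sandwichedD α) (QDiv.tensorPow n N) (QDiv.tensorPow n M) ∧
    ((1 / (n : ℝ) : ℝ) : EReal) *
        QDiv.channelDiv (QDiv.sandwichedD α) (QDiv.tensorPow n N) (QDiv.tensorPow n M) ≤
      ((1 / (n : ℝ) : ℝ) : EReal) *
        QDiv.channelDiv (QDiv.sharpD α) (QDiv.tensorPow n N) (QDiv.tensorPow n M) := by
  have hn0 : (0 : ℝ) < 1 / n := one_div_pos.2 (by exact_mod_cast hn)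
  refine ⟨?_, QDiv.coe_mul_le_coe_mul hn0.le (QDiv.channelDiv_sandwichedD_le hα n hN hM)⟩
  rw [EReal.sub_le_iff_le_add (Or.inl (EReal.coe_ne_bot _)) (Or.inl (EReal.coe_ne_top _))]
  refine (QDiv.coe_mul_le_coe_mul hn0.le (QDiv.channelDiv_sharpD_le hα n hN hM)).trans ?_
  rw [QDiv.coe_mul_add_coe hn0]
  refine add_le_add_right ?_ _
  rw [EReal.coe_le_coe_iff, ← hd, mul_assoc, mul_assoc]
  refine mul_le_mul_of_nonneg_left (mul_le_mul_of_nonneg_left (QDiv.logb_pow_le hn) ?_) hn0.le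
  exact div_nonneg (by linarith) (by linarith)
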